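/- Let $d\ge 2$, let $T_d$ be the $d$-regular tree, and let $G=T_d\Box\mathbb{Z}$ be the Cartesian product of $T_d$ with the line $\mathbb{Z}$. For $p\in[0,1]$ let $\mathbb{P}_p$ be the law of Bernoulli bond percolation on $G$, in which each edge is independently open with probability $p$ and closed with probability $1-p$; write $x\leftrightarrow y$ for the event that $x$ and $y$ are joined by a path of open edges, and call the connected components of the open subgraph clusters. Let $$p_c=\inf\{p\in[0,1] : \mathbb{P}_p\text{-almost surely there exists an infinite cluster}\},$$ $$\alpha(p)=\lim_{n\to\infty}\mathbb{P}_p\bigl((o,0)\leftrightarrow(v_n,0)\bigr)^{1/n},\qquad \mathrm{gr}(G)=\liminf_{r\to\infty}|B(x,r)|^{1/r},$$ where $o$ is a vertex of $T_d$, $v_n$ is a vertex of $T_d$ at distance $n$ from $o$, $x$ is a vertex of $G$, and $B(x,r)$ is the ball of radius $r$ around $x$ in the graph distance of $G$. Then the limit defining $\alpha(p_c)$ exists and does not depend on the choice of $o$ and of the vertices $v_n$, and, for every vertex $x$ of $G$, $$\alpha(p_c)\le \mathrm{gr}(G)^{-1}=\frac{1}{d-1}.$$ -/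

import Mathlib

namespace TreeLinePercolation

open MeasureTheory ProbabilityTheory Filter Topology unitInterval
open SimpleGraph (hasse)

/-- A configuration of bond percolation on `G`: an edge `e` is open iff `ω e = true`. -/
abbrev Config {V : Type*} (G : SimpleGraph V) : Type _ := G.edgeSet → Bool

/-- The law of Bernoulli bond percolation on `G`: each edge is independently open with
probability `p` and closed with probability `1 - p`. -/
noncomputable def perc {V : Type*} (G : SimpleGraph V) (p : I) : Measure (Config G) :=
  Measure.infinitePi fun _ : G.edgeSet => bernoulliMeasure true false p

/-- The subgraph consisting of all open edges. -/
def openGraph {V : Type*} (G : SimpleGraph V) (ω : Config G) : SimpleGraph V :=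
  SimpleGraph.fromEdgeSet {e | ∃ h : e ∈ G.edgeSet, ω ⟨e, h⟩ = true}

/-- The probability that there is an open path between `x` and `y`. -/
noncomputable def tau {V : Type*} (G : SimpleGraph V) (p : I) (x y : V) : ℝ :=
  (perc G p).real {ω | (openGraph G ω).Reachable x y}

/-- Some cluster (connected component of the open subgraph) is infinite. -/
def HasInfiniteCluster {V : Type*} (G : SimpleGraph V) (ω : Config G) : Prop :=
  ∃ C : (openGraph G ω).ConnectedComponent, C.supp.Infinite

/-- The critical probability: the infimum of all `p ∈ [0, 1]` for which there is an infinite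
cluster almost surely (an infimum in the complete lattice `[0, 1]`). -/
noncomputable def pc {V : Type*} (G : SimpleGraph V) : I :=
  sInf {p : I | ∀ᵐ ω ∂(perc G p), HasInfiniteCluster G ω}

/-- The growth rate `liminf_{r → ∞} |B(x, r)| ^ (1 / r)` of `G` seen from `x`. -/
noncomputable def gr {V : Type*} (G : SimpleGraph V) (x : V) : ℝ :=
  liminf (fun r : ℕ => ((Set.ncard {y | G.edist x y ≤ r} : ℕ) : ℝ) ^ (1 / (r : ℝ))) atTop

/-- The Cartesian product `T □ ℤ` of a graph `T` and the line. -/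
noncomputable abbrev treeLine {V : Type*} (T : SimpleGraph V) : SimpleGraph (V × ℤ) :=
  T.boxProd (hasse ℤ)

/-- `a` is the limit of `P_p((o, 0) ↔ (v_n, 0)) ^ (1 / n)` on `T □ ℤ`, whatever the origin `o` and
the vertices `v_n` of `T` at distance `n` from `o`. -/
def IsAlpha {V : Type*} (T : SimpleGraph V) (p : I) (a : ℝ) : Prop :=
  ∀ (o : V) (v : ℕ → V), (∀ n, T.edist o (v n) = n) →
    Tendsto (fun n : ℕ => tau (treeLine T) p (o, 0) (v n, 0) ^ (1 / (n : ℝ))) atTop (𝓝 a)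

/-- The function `α(p)`: the limit described by `IsAlpha`, and an unspecified real number if there
is no such limit. -/
noncomputable def alpha {V : Type*} (T : SimpleGraph V) (p : I) : ℝ :=
  Classical.epsilon (IsAlpha T p)

end TreeLinePercolation

/-!
Write `b = d - 1` and `τ_p(n)` for the probability that `(o, 0)` and `(v, 0)` are connected, where
`v` is at distance `n` from `o`. The tree is distance-transitive (`exists_iso`), so `τ_p(n)`
depends on `n` only, and by the Harris inequality (`harris`) it is supermultiplicative. Fekete's
lemma yields the limit `α(p)` (`exists_isAlpha`). The growth rate is `b` since `b ^ r` and a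
polynomial multiple of `b ^ r` bound the size of the ball of radius `r` (`gr_treeLine`).

The inequality at `p_c` rests on the following claim: if `b ^ n * τ_p(n) > 1` holds for some `n`,
even when only a finite set of edges may be used, then there is an infinite cluster almost surely
(`ae_hasInfiniteCluster_of_lt`). For fixed finite sets of edges, connection probabilities are
polynomials in `p`, so `b ^ n * τ(n) > 1` at `p_c` would persist with finitely many edges at some
`p < p_c`, contrary to the definition of `p_c` (`tau_pc_le`). Hence `τ(n) ≤ b ^ (-n)` at `p_c`.

For the claim, connections over `n` steps that stay within distance `R` of their starting line are
chained along a geodesic of the tree, with a straight piece of length about `R` at either end. The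
resulting connection stays in the slab between the levels of its end points, inside the subtree of
descendants of its starting point (`le_connProb_slabEdges`); if its total length is `N`, its
probability `c` satisfies `b ^ N * c > 1` once the chain is long enough. Slabs of different
generations and the subtrees of different vertices share no edges, so the vertices reached by
repeated slab crossings form a branching process of mean `b ^ N * c`, which survives with positive
probability (`le_real_surv`). For `b ≥ 2` there are arbitrarily many disjoint subtrees to start it
in, hence an infinite cluster almost surely (`ae_hasInfiniteCluster`). For `b = 1` the bound `α ≤
1` is trivial.
-/

namespace TreeLinePercolation

open MeasureTheory ProbabilityTheory Filter Topology unitInterval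
open SimpleGraph (hasse)

/-! ### Distances in trees -/

section Tree

variable {V : Type*} {T : SimpleGraph V}

/-- The part of a tree `T` that lies on the side of `u` of the edge from `a` to `u`. -/
def side (T : SimpleGraph V) (a u : V) : Set V := {x | T.dist a x = T.dist u x + 1}

lemma dist_adj_cases (hT : T.IsTree) {a u : V} (h : T.Adj a u) (x : V) :
    T.dist a x = T.dist u x + 1 ∨ T.dist u x = T.dist a x + 1 := by
  have := hT.dist_eq_dist_add_one_of_adj x h
  simpa only [T.dist_comm (u := x)] using this

lemma notMem_side (hT : T.IsTree) {a u : V} (h : T.Adj a u) {x : V} :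
    x ∉ side T a u ↔ T.dist u x = T.dist a x + 1 := by
  have := dist_adj_cases hT h x
  simp only [side, Set.mem_ofPred_eq]
  omega

lemma dist_add_of_mem_support {x y z : V} (p : T.Walk x y) (hp : p.length = T.dist x y)
    (hz : z ∈ p.support) (hT : T.IsTree) : T.dist x y = T.dist x z + T.dist z y := by
  classical
  have h1 := T.dist_le (p.takeUntil z hz)
  have h2 := T.dist_le (p.dropUntil z hz)
  have h3 := congrArg SimpleGraph.Walk.length (p.take_spec hz)
  rw [SimpleGraph.Walk.length_append] at h3
  have := hT.connected.dist_triangle (u := x) (v := z) (w := y)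
  omega

/-- Every path between the two sides of an edge of a tree runs through that edge. -/
lemma dist_of_mem_side (hT : T.IsTree) {a u x y : V} (h : T.Adj a u) (hx : x ∈ side T a u)
    (hy : y ∉ side T a u) : T.dist y x = T.dist y a + 1 + T.dist u x := by
  classical
  obtain ⟨p, hpp, hp⟩ := hT.connected.exists_path_of_dist y a
  obtain ⟨q, hqp, hq⟩ := hT.connected.exists_path_of_dist u x
  have tri : ∀ r s t, T.dist r t ≤ T.dist r s + T.dist s t := fun r s t =>
    hT.connected.dist_triangle
  have h1 : ∀ z ∈ p.support, z ∉ side T a u := by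
    intro z hz hz'
    have e1 := dist_add_of_mem_support p hp hz hT
    have e2 := (notMem_side hT h).1 hy
    have e3 : T.dist a z = T.dist u z + 1 := hz'
    have e4 := tri u z y
    rw [T.dist_comm (u := z) (v := y), T.dist_comm (u := u) (v := y)] at e4
    rw [T.dist_comm (u := u) (v := y), T.dist_comm (u := a) (v := y)] at e2
    rw [T.dist_comm (u := z) (v := a)] at e1
    omega
  have h2 : ∀ z ∈ q.support, z ∈ side T a u := by
    intro z hz
    by_contra hz'
    have e1 := dist_add_of_mem_support q hq hz hT
    have e2 := (notMem_side hT h).1 hz'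
    have e3 : T.dist a x = T.dist u x + 1 := hx
    have e4 := tri a z x
    omega
  have hpath : (p.append (SimpleGraph.Walk.cons h q)).IsPath := by
    rw [SimpleGraph.Walk.isPath_def, SimpleGraph.Walk.support_append, List.nodup_append]
    refine ⟨hpp.support_nodup, by simpa using hqp.support_nodup, ?_⟩
    intro z hz w hw hzw
    subst hzw
    exact h1 z hz (h2 z (by simpa using hw))
  obtain ⟨r, hrp, hr⟩ := hT.connected.exists_path_of_dist y x
  have : r = p.append (SimpleGraph.Walk.cons h q) :=
    congrArg Subtype.val
      (@Subsingleton.elim _ (hT.isAcyclic.subsingleton_path y x) ⟨r, hrp⟩ ⟨_, hpath⟩)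
  rw [← hr, this, SimpleGraph.Walk.length_append, SimpleGraph.Walk.length_cons, hp, hq]
  omega

lemma exists_adj_dist (hT : T.IsTree) {o x : V} (hx : x ≠ o) :
    ∃ z, T.Adj z x ∧ T.dist o x = T.dist o z + 1 := by
  obtain ⟨p, hp⟩ := hT.connected.exists_walk_length_eq_dist x o
  cases p with
  | nil => exact absurd rfl hx
  | @cons _ z _ h q =>
    refine ⟨z, h.symm, ?_⟩
    have h1 := T.dist_le q
    rw [SimpleGraph.Walk.length_cons] at hp
    have h2 := dist_adj_cases hT h o
    rw [T.dist_comm (u := o), T.dist_comm (u := o)]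
    omega

lemma adj_dist_unique (hT : T.IsTree) {o x z w : V} (hz : T.Adj z x) (hw : T.Adj w x)
    (hz' : T.dist o x = T.dist o z + 1) (hw' : T.dist o x = T.dist o w + 1) : z = w := by
  by_contra hne
  have h1 : o ∉ side T z x := by
    rw [notMem_side hT hz, T.dist_comm, hz', T.dist_comm]
  have h2 : w ∈ side T z x := by
    have e1 : T.dist x w = 1 := SimpleGraph.dist_eq_one_iff_adj.2 hw.symm
    rcases dist_adj_cases hT hz w with h | h
    · exact h
    · have : T.dist z w = 0 := by omega
      exact absurd (hT.connected.dist_eq_zero_iff.1 this) hne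
  have := dist_of_mem_side hT hz h2 h1
  omega

open Classical in
/-- The parent of `x` in the tree `T` rooted at `o`; the value at the root is `x` itself. -/
noncomputable def par (T : SimpleGraph V) (o x : V) : V :=
  if h : ∃ z, T.Adj z x ∧ T.dist o x = T.dist o z + 1 then h.choose else x

lemma par_adj (hT : T.IsTree) {o x : V} (hx : x ≠ o) : T.Adj (par T o x) x := by
  have h := exists_adj_dist hT hx
  rw [par, dif_pos h]
  exact h.choose_spec.1

lemma dist_par (hT : T.IsTree) {o x : V} (hx : x ≠ o) : T.dist o x = T.dist o (par T o x) + 1 := by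
  have h := exists_adj_dist hT hx
  rw [par, dif_pos h]
  exact h.choose_spec.2

lemma eq_par (hT : T.IsTree) {o x z : V} (h : T.Adj z x) (h' : T.dist o x = T.dist o z + 1) :
    z = par T o x := by
  have hx : x ≠ o := by
    rintro rfl
    simp at h'
  exact adj_dist_unique hT h (par_adj hT hx) h' (dist_par hT hx)

lemma ne_of_dist_eq_succ {o x : V} {n : ℕ} (h : T.dist o x = n + 1) : x ≠ o := by
  rintro rfl
  simp at h

/-! ### Descendants of an oriented edge -/

open Classical in
/-- The vertices at distance `n` from `u` on the side of `u` of the edge from `a` to `u`. -/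
noncomputable def level (T : SimpleGraph V) [T.LocallyFinite] (a u : V) : ℕ → Finset V
  | 0 => {u}
  | n + 1 => (level T a u n).biUnion fun v => (T.neighborFinset v).erase (par T a v)

variable [T.LocallyFinite]

lemma mem_level (hT : T.IsTree) {a u : V} (h : T.Adj a u) {n : ℕ} {v : V} :
    v ∈ level T a u n ↔ T.dist u v = n ∧ T.dist a v = n + 1 := by
  classical
  have hau : T.dist a u = 1 := SimpleGraph.dist_eq_one_iff_adj.2 h
  induction n generalizing v with
  | zero =>
    simp only [level, Finset.mem_singleton]
    constructor
    · rintro rfl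
      simp [hau]
    · rintro ⟨h1, -⟩
      exact (hT.connected.dist_eq_zero_iff.1 h1).symm
  | succ n ih =>
    simp only [level, Finset.mem_biUnion, Finset.mem_erase, SimpleGraph.mem_neighborFinset]
    constructor
    · rintro ⟨w, hw, hv, hwv⟩
      obtain ⟨h1, h2⟩ := ih.1 hw
      have e1 : T.dist a v = n + 2 := by
        rcases hT.dist_eq_dist_add_one_of_adj a hwv with e | e
        · exact absurd (eq_par hT hwv.symm e) hv
        · omega
      have e2 := hT.dist_eq_dist_add_one_of_adj u hwv
      have e3 := dist_adj_cases hT h v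
      omega
    · rintro ⟨h1, h2⟩
      have hvu := ne_of_dist_eq_succ h1
      have h3 := par_adj hT hvu
      have h4 := dist_par hT hvu
      have h5 := hT.dist_eq_dist_add_one_of_adj a h3
      have h6 := dist_adj_cases hT h (par T u v)
      have h7 : T.dist a (par T u v) = n + 1 := by omega
      refine ⟨par T u v, ih.2 ⟨by omega, h7⟩, ?_, h3⟩
      intro e
      have := dist_par hT (ne_of_dist_eq_succ h7)
      rw [← e] at this
      omega

lemma ne_of_mem_level (hT : T.IsTree) {a u : V} (h : T.Adj a u) {n : ℕ} {v : V}
    (hv : v ∈ level T a u n) : v ≠ a :=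
  ne_of_dist_eq_succ ((mem_level hT h).1 hv).2

/-- Every vertex other than the root has `d - 1` children. -/
lemma card_erase_par (hT : T.IsTree) {d : ℕ} (hreg : T.IsRegularOfDegree d) {o x : V}
    (hx : x ≠ o) [DecidableEq V] : ((T.neighborFinset x).erase (par T o x)).card = d - 1 := by
  rw [Finset.card_erase_of_mem (by simpa using (par_adj hT hx).symm),
    SimpleGraph.card_neighborFinset_eq_degree, hreg x]

lemma card_level (hT : T.IsTree) {d : ℕ} (hreg : T.IsRegularOfDegree d) {a u : V}
    (h : T.Adj a u) (n : ℕ) : (level T a u n).card = (d - 1) ^ n := by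
  classical
  induction n with
  | zero => simp [level]
  | succ n ih =>
    rw [level, Finset.card_biUnion, Finset.sum_congr rfl fun v hv =>
      card_erase_par hT hreg (ne_of_mem_level hT h hv)]
    · simp [ih, pow_succ]
    · intro v hv w hw hvw
      rw [Function.onFun, Finset.disjoint_left]
      intro z hz hz'
      simp only [Finset.mem_erase, SimpleGraph.mem_neighborFinset] at hz hz'
      have key : ∀ v ∈ level T a u n, z ≠ par T a v → T.Adj v z → v = par T a z := by
        intro v hv h1 h2
        refine eq_par hT h2 ?_
        rcases hT.dist_eq_dist_add_one_of_adj a h2 with e | e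
        · exact absurd (eq_par hT h2.symm e) h1
        · exact e
      exact hvw ((key v hv hz.1 hz.2).trans (key w hw hz'.1 hz'.2).symm)

lemma par_adj_of_mem_level (hT : T.IsTree) {a u : V} (h : T.Adj a u) {n : ℕ} {v : V}
    (hv : v ∈ level T a u n) : T.Adj (par T a v) v :=
  par_adj hT (ne_of_mem_level hT h hv)

/-- Distances add up along descendants: a vertex beyond `v` is reached from `u` and from `a` through
`v` only. -/
lemma dist_of_mem_level (hT : T.IsTree) {a u : V} (h : T.Adj a u) {n : ℕ} {v x : V}
    (hv : v ∈ level T a u n) (hx : x ∈ side T (par T a v) v) :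
    T.dist u x = n + T.dist v x ∧ T.dist a x = n + 1 + T.dist v x := by
  have h1 := par_adj_of_mem_level hT h hv
  have h2 := dist_par hT (ne_of_mem_level hT h hv)
  have h3 : a ∉ side T (par T a v) v := by
    rw [notMem_side hT h1, T.dist_comm, h2, T.dist_comm]
  have h4 := dist_of_mem_side hT h1 hx h3
  obtain ⟨h5, h6⟩ := (mem_level hT h).1 hv
  have h7 := hT.connected.dist_triangle (u := u) (v := v) (w := x)
  have h8 := dist_adj_cases hT h x
  omega

lemma side_subset_of_mem_level (hT : T.IsTree) {a u : V} (h : T.Adj a u) {n : ℕ} {v : V}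
    (hv : v ∈ level T a u n) : side T (par T a v) v ⊆ side T a u := by
  intro x hx
  obtain ⟨h1, h2⟩ := dist_of_mem_level hT h hv hx
  simp only [side, Set.mem_ofPred_eq]
  omega

/-- The subtrees of descendants of distinct vertices of one level are disjoint. -/
lemma eq_of_mem_side_of_mem_level (hT : T.IsTree) {a u : V} (h : T.Adj a u) {n : ℕ} {v w x : V}
    (hv : v ∈ level T a u n) (hw : w ∈ level T a u n) (hxv : x ∈ side T (par T a v) v)
    (hxw : x ∈ side T (par T a w) w) : v = w := by
  by_contra hne
  have key : ∀ v w, v ∈ level T a u n → w ∈ level T a u n → v ≠ w →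
      x ∈ side T (par T a v) v → T.dist v x < T.dist w x := by
    intro v w hv hw hne hx
    have h1 := par_adj_of_mem_level hT h hv
    have h2 : w ∉ side T (par T a v) v := by
      intro hw'
      have e1 := (dist_of_mem_level hT h hv hw').2
      have e2 := ((mem_level hT h).1 hw).2
      have e3 : T.dist v w = 0 := by omega
      exact hne (hT.connected.dist_eq_zero_iff.1 e3)
    have := dist_of_mem_side hT h1 hx h2
    omega
  have h1 := key v w hv hw hne hxv
  have h2 := key w v hw hv (Ne.symm hne) hxw
  omega

end Tree

section Aut

variable {V : Type*} {T : SimpleGraph V}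

/-! ### Distance-transitivity of the regular tree -/

/-- Two finite sets of the same size are matched by a map that respects a marked point. -/
lemma exists_matching {s t : Finset V} (h : s.card = t.card) (m m' : V) :
    ∃ g : V → V, (∀ x ∈ s, g x ∈ t) ∧ Set.InjOn g s ∧ (∀ y ∈ t, ∃ x ∈ s, g x = y) ∧
      (m ∈ s → m' ∈ t → g m = m') := by
  classical
  obtain ⟨e, he⟩ : ∃ e : s ≃ t, ∀ (hm : m ∈ s) (hm' : m' ∈ t), e ⟨m, hm⟩ = ⟨m', hm'⟩ := by
    let e := Finset.equivOfCardEq h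
    by_cases hm : m ∈ s
    · by_cases hm' : m' ∈ t
      · exact ⟨e.trans (Equiv.swap (e ⟨m, hm⟩) ⟨m', hm'⟩), fun _ _ => by simp⟩
      · exact ⟨e, fun _ h => absurd h hm'⟩
    · exact ⟨e, fun h => absurd h hm⟩
  have hg : ∀ x (hx : x ∈ s), (if hx : x ∈ s then (e ⟨x, hx⟩ : V) else x) = e ⟨x, hx⟩ :=
    fun x hx => dif_pos hx
  refine ⟨fun x => if hx : x ∈ s then (e ⟨x, hx⟩ : V) else x, ?_, ?_, ?_, ?_⟩
  · intro x hx
    simp only [hg x hx, Finset.coe_mem]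
  · intro x hx y hy hxy
    simp only [hg x hx, hg y hy] at hxy
    exact congrArg Subtype.val (e.injective (Subtype.ext hxy))
  · intro y hy
    refine ⟨e.symm ⟨y, hy⟩, Finset.coe_mem _, ?_⟩
    exact (hg _ (Finset.coe_mem _)).trans (by simp)
  · intro hm hm'
    exact (hg m hm).trans (congrArg Subtype.val (he hm hm'))

lemma dist_iso (hT : T.IsTree) (f : T ≃g T) (x y : V) : T.dist (f x) (f y) = T.dist x y := by
  have key : ∀ (f : T ≃g T) (x y : V), T.dist (f x) (f y) ≤ T.dist x y := by
    intro f x y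
    obtain ⟨p, hp⟩ := hT.connected.exists_walk_length_eq_dist x y
    rw [← hp, ← SimpleGraph.Walk.length_map f.toHom p]
    exact T.dist_le _
  refine le_antisymm (key f x y) ?_
  simpa using key f.symm (f x) (f y)

variable [T.LocallyFinite]

open Classical in
/-- The children of `x` in the tree `T` rooted at `o`. -/
noncomputable def children (T : SimpleGraph V) [T.LocallyFinite] (o x : V) : Finset V :=
  {z ∈ T.neighborFinset x | T.dist o z = T.dist o x + 1}

lemma mem_children {o x z : V} :
    z ∈ children T o x ↔ T.Adj x z ∧ T.dist o z = T.dist o x + 1 := by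
  simp [children]

lemma card_children (hT : T.IsTree) {d : ℕ} (hreg : T.IsRegularOfDegree d) {o x o' x' : V}
    (h : T.dist o x = T.dist o' x') : (children T o x).card = (children T o' x').card := by
  classical
  have key : ∀ o x : V, (children T o x).card = if T.dist o x = 0 then d else d - 1 := by
    intro o x
    split_ifs with h0
    · obtain rfl := hT.connected.dist_eq_zero_iff.1 h0
      rw [← hreg o, ← SimpleGraph.card_neighborFinset_eq_degree, children,
        Finset.filter_true_of_mem]
      intro z hz
      rw [SimpleGraph.mem_neighborFinset] at hz
      rw [h0, SimpleGraph.dist_eq_one_iff_adj.2 hz]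
    · have hx : x ≠ o := by
        rintro rfl
        simp at h0
      rw [← card_erase_par hT hreg hx]
      congr 1
      ext z
      rw [mem_children, Finset.mem_erase, SimpleGraph.mem_neighborFinset]
      constructor
      · rintro ⟨h1, h2⟩
        refine ⟨?_, h1⟩
        rintro rfl
        have := dist_par hT hx
        omega
      · rintro ⟨h1, h2⟩
        refine ⟨h2, ?_⟩
        rcases hT.dist_eq_dist_add_one_of_adj o h2 with e | e
        · exact absurd (eq_par hT h2.symm e) h1
        · exact e
  rw [key, key, h]

/-- A regular tree is distance-transitive. The automorphism is built by recursion on the distance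
from `o`: the children of each vertex are matched with the children of its image, the child
towards `v` going to the child towards `v'`. -/
lemma exists_iso (hT : T.IsTree) {d : ℕ} (hreg : T.IsRegularOfDegree d) {o v o' v' : V}
    (h : T.dist o v = T.dist o' v') : ∃ f : T ≃g T, f o = o' ∧ f v = v' := by
  classical
  have hg : ∀ a b : V, ∃ g : V → V, T.dist o a = T.dist o' b →
      (∀ x ∈ children T o a, g x ∈ children T o' b) ∧ Set.InjOn g (children T o a) ∧
      (∀ y ∈ children T o' b, ∃ x ∈ children T o a, g x = y) ∧
      (par T v a ∈ children T o a → par T v' b ∈ children T o' b →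
        g (par T v a) = par T v' b) := by
    intro a b
    by_cases hab : T.dist o a = T.dist o' b
    · obtain ⟨g, hg⟩ := exists_matching (card_children hT hreg hab) (par T v a) (par T v' b)
      exact ⟨g, fun _ => hg⟩
    · exact ⟨id, fun h => absurd h hab⟩
  choose g hg using hg
  -- `F n` is the intended map on the sphere of radius `n`.
  let F : ℕ → V → V := fun n => n.rec (fun _ => o') fun _ F x => g (par T o x) (F (par T o x)) x
  let f : V → V := fun x => F (T.dist o x) x
  have f_o : f o = o' := by simp [f, F]
  have f_ne : ∀ x, x ≠ o → f x = g (par T o x) (f (par T o x)) x := by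
    intro x hx
    simp only [f, dist_par hT hx]
    rfl
  have mem_ch : ∀ x, x ≠ o → x ∈ children T o (par T o x) := fun x hx =>
    mem_children.2 ⟨par_adj hT hx, dist_par hT hx⟩
  -- Induction on the distance from the root.
  have ind : ∀ P : V → Prop, P o → (∀ x, x ≠ o → P (par T o x) → P x) → ∀ x, P x := by
    intro P h0 hs x
    induction hn : T.dist o x generalizing x with
    | zero => rwa [← hT.connected.dist_eq_zero_iff.1 hn]
    | succ n ih =>
      have hx := ne_of_dist_eq_succ hn
      refine hs x hx (ih _ ?_)
      have := dist_par hT hx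
      omega
  have f_dist : ∀ x, T.dist o' (f x) = T.dist o x := by
    refine ind _ (by simp [f_o]) fun x hx ih => ?_
    have h1 := (mem_children.1 ((hg _ _ ih.symm).1 x (mem_ch x hx))).2
    rw [f_ne x hx, h1, ih, ← dist_par hT hx]
  have f_mem : ∀ x, x ≠ o → f x ∈ children T o' (f (par T o x)) := fun x hx => by
    rw [f_ne x hx]
    exact (hg _ _ (f_dist _).symm).1 x (mem_ch x hx)
  have f_par : ∀ x, x ≠ o → f (par T o x) = par T o' (f x) := fun x hx =>
    have h1 := mem_children.1 (f_mem x hx)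
    eq_par hT h1.1 h1.2
  have f_ne' : ∀ x, x ≠ o → f x ≠ o' := by
    intro x hx e
    have h1 := f_dist x
    rw [e, SimpleGraph.dist_self] at h1
    exact hx (hT.connected.dist_eq_zero_iff.1 h1.symm).symm
  have f_inj : Function.Injective f := by
    have : ∀ x y, f x = f y → x = y := by
      refine ind _ ?_ fun x hx ih => ?_
      · intro y hxy
        by_contra hne
        exact f_ne' y (Ne.symm hne) (by rw [← hxy, f_o])
      · intro y hxy
        have hy : y ≠ o := by
          rintro rfl
          exact f_ne' x hx (by rw [hxy, f_o])
        have h1 : par T o x = par T o y := by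
          apply ih
          rw [f_par x hx, f_par y hy, hxy]
        have h2 := mem_ch y hy
        rw [f_ne x hx, f_ne y hy, ← h1] at hxy
        rw [← h1] at h2
        exact (hg _ _ (f_dist _).symm).2.1 (mem_ch x hx) h2 hxy
    exact fun x y => this x y
  have f_surj : Function.Surjective f := by
    intro y
    induction hn : T.dist o' y generalizing y with
    | zero => exact ⟨o, by rw [f_o, hT.connected.dist_eq_zero_iff.1 hn]⟩
    | succ n ih =>
      have hy := ne_of_dist_eq_succ hn
      have h1 := dist_par hT hy
      obtain ⟨a, ha⟩ := ih (par T o' y) (by omega)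
      obtain ⟨x, hx, hxy⟩ := (hg a (f a) (f_dist a).symm).2.2.1 y
        (by rw [ha]; exact mem_children.2 ⟨par_adj hT hy, h1⟩)
      have h2 := mem_children.1 hx
      have h3 := eq_par hT h2.1 h2.2
      refine ⟨x, ?_⟩
      rw [f_ne x (ne_of_dist_eq_succ h2.2), ← h3, hxy]
  have f_adj : ∀ x y, T.Adj (f x) (f y) ↔ T.Adj x y := by
    have key : ∀ x y, T.Adj x y → T.dist o y = T.dist o x + 1 → T.Adj (f x) (f y) := by
      intro x y hxy hd
      have hy := ne_of_dist_eq_succ hd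
      have := (mem_children.1 (f_mem y hy)).1
      rwa [← eq_par hT hxy hd] at this
    have key' : ∀ x y, T.Adj (f x) (f y) → T.dist o' (f y) = T.dist o' (f x) + 1 →
        T.Adj x y := by
      intro x y hxy hd
      have hd' := hd
      rw [f_dist, f_dist] at hd'
      have hy := ne_of_dist_eq_succ hd'
      have h1 := eq_par hT hxy hd
      rw [← f_par y hy] at h1
      rw [f_inj h1]
      exact par_adj hT hy
    intro x y
    constructor
    · intro hxy
      rcases hT.dist_eq_dist_add_one_of_adj o' hxy with e | e
      · exact (key' _ _ hxy.symm e).symm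
      · exact key' _ _ hxy e
    · intro hxy
      rcases hT.dist_eq_dist_add_one_of_adj o hxy with e | e
      · exact (key _ _ hxy.symm e).symm
      · exact key _ _ hxy e
  refine ⟨⟨Equiv.ofBijective f ⟨f_inj, f_surj⟩, fun {x y} => f_adj x y⟩, f_o, ?_⟩
  -- The geodesic from `o` to `v` is mapped onto the geodesic from `o'` to `v'`.
  have main : ∀ x, T.dist o x + T.dist v x = T.dist o v →
      T.dist o x + T.dist v' (f x) = T.dist o v := by
    refine ind _ ?_ fun x hx ih => ?_
    · intro _
      rw [f_o, SimpleGraph.dist_self, T.dist_comm, h, zero_add]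
    · intro hxv
      have h1 := dist_par hT hx
      have h2 := par_adj hT hx
      have e1 : T.dist v (par T o x) = T.dist v x + 1 := by
        rcases hT.dist_eq_dist_add_one_of_adj v h2 with e | e
        · exact e
        · have := hT.connected.dist_triangle (u := o) (v := par T o x) (w := v)
          rw [T.dist_comm (u := par T o x) (v := v)] at this
          omega
      have e2 := ih (by omega)
      set a := par T o x with ha
      have hx' : x = par T v a := eq_par hT h2.symm e1
      have ha' : f a ≠ v' := by
        intro e
        rw [e, SimpleGraph.dist_self] at e2
        omega
      have e3 := par_adj hT ha'
      have e4 := dist_par hT ha'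
      have e5 : par T v' (f a) ∈ children T o' (f a) := by
        refine mem_children.2 ⟨e3.symm, ?_⟩
        rcases hT.dist_eq_dist_add_one_of_adj o' e3 with e | e
        · exact e
        · have := hT.connected.dist_triangle (u := o') (v := par T v' (f a)) (w := v')
          rw [T.dist_comm (u := par T v' (f a)) (v := v'), ← h] at this
          rw [f_dist] at e
          omega
      have e6 := (hg a (f a) (f_dist a).symm).2.2.2 (hx' ▸ mem_ch x hx) e5
      rw [← hx', ← f_ne x hx] at e6
      rw [e6]
      omega
  have := main v (by simp)
  exact (hT.connected.dist_eq_zero_iff.1 (by omega : T.dist v' (f v) = 0)).symm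

/-! ### Spheres and balls -/

lemma card_sphere_le (hT : T.IsTree) {d : ℕ} (hreg : T.IsRegularOfDegree d) (o : V) (n : ℕ) :
    {x | T.dist o x = n + 1}.Finite ∧ {x | T.dist o x = n + 1}.ncard ≤ d * (d - 1) ^ n := by
  classical
  have hsub : {x | T.dist o x = n + 1} ⊆
      ((T.neighborFinset o).biUnion fun u => level T o u n : Finset V) := by
    intro x hx
    have hx' : T.dist o x = n + 1 := hx
    have hne := ne_of_dist_eq_succ hx'
    have h1 := par_adj hT (Ne.symm hne)
    have h2 := dist_par hT (Ne.symm hne)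
    rw [T.dist_comm (u := x), T.dist_comm (u := x)] at h2
    simp only [Finset.coe_biUnion, Set.mem_iUnion, Finset.mem_coe,
      SimpleGraph.mem_neighborFinset]
    exact ⟨_, h1.symm, (mem_level hT h1.symm).2 ⟨by omega, hx'⟩⟩
  refine ⟨(Finset.finite_toSet _).subset hsub, ?_⟩
  refine (Set.ncard_le_ncard hsub (Finset.finite_toSet _)).trans ?_
  rw [Set.ncard_coe_finset]
  refine Finset.card_biUnion_le.trans ?_
  rw [Finset.sum_congr rfl fun u hu =>
    card_level hT hreg ((T.mem_neighborFinset _ _).1 hu) n]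
  simp [hreg o]

lemma card_ball_le (hT : T.IsTree) {d : ℕ} (hd : 2 ≤ d) (hreg : T.IsRegularOfDegree d) (o : V)
    (r : ℕ) : {x | T.dist o x ≤ r}.Finite ∧
      {x | T.dist o x ≤ r}.ncard ≤ (r + 1) * (d * (d - 1) ^ r) := by
  induction r with
  | zero =>
    have : {x | T.dist o x ≤ 0} = {o} := by
      ext x
      simp [hT.connected.dist_eq_zero_iff, eq_comm]
    rw [this]
    simp
    omega
  | succ r ih =>
    have hu : {x | T.dist o x ≤ r + 1} = {x | T.dist o x ≤ r} ∪ {x | T.dist o x = r + 1} := by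
      ext x
      simp only [Set.mem_ofPred_eq, Set.mem_union]
      omega
    obtain ⟨h1, h2⟩ := card_sphere_le hT hreg o r
    rw [hu]
    refine ⟨ih.1.union h1, (Set.ncard_union_le _ _).trans ((add_le_add ih.2 h2).trans ?_)⟩
    have h3 : d * (d - 1) ^ r ≤ d * (d - 1) ^ (r + 1) :=
      Nat.mul_le_mul_left _ (Nat.pow_le_pow_right (by omega) (by omega))
    calc _ = (r + 2) * (d * (d - 1) ^ r) := by ring
      _ ≤ _ := Nat.mul_le_mul_left _ h3

lemma countable_of_isTree (hT : T.IsTree) {d : ℕ} (hd : 2 ≤ d) (hreg : T.IsRegularOfDegree d) :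
    Countable V := by
  obtain ⟨o⟩ := hT.connected.nonempty
  have h : (Set.univ : Set V) = ⋃ r : ℕ, {x | T.dist o x ≤ r} := by
    ext x
    simp only [Set.mem_univ, Set.mem_iUnion, true_iff]
    exact ⟨T.dist o x, le_refl (T.dist o x)⟩
  rw [← Set.countable_univ_iff, h]
  exact Set.countable_iUnion fun r => (card_ball_le hT hd hreg o r).1.countable

lemma exists_dist_eq (hT : T.IsTree) {d : ℕ} (hd : 2 ≤ d) (hreg : T.IsRegularOfDegree d) (o : V)
    (n : ℕ) : ∃ v, T.dist o v = n := by
  obtain ⟨u, hu⟩ : ∃ u, T.Adj o u := by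
    rw [← SimpleGraph.degree_pos_iff_exists_adj, hreg o]
    omega
  have : (level T o u n).card ≠ 0 := by
    rw [card_level hT hreg hu]
    exact pow_ne_zero _ (by omega)
  obtain ⟨v, hv⟩ := Finset.card_ne_zero.1 this
  cases n with
  | zero => exact ⟨o, by simp⟩
  | succ n =>
    have := (mem_level hT hu).1 hv
    refine ⟨par T o v, ?_⟩
    have := dist_par hT (ne_of_mem_level hT hu hv)
    omega

end Aut

section Growth

variable {V : Type*} {T : SimpleGraph V}

/-! ### Growth -/

lemma abs_sub_le_of_edist_le {a b : ℤ} {r : ℕ} (h : (hasse ℤ).edist a b ≤ r) : |b - a| ≤ r := by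
  have key : ∀ (a b : ℤ) (p : (hasse ℤ).Walk a b), |b - a| ≤ p.length := by
    intro a b p
    induction p with
    | nil => simp
    | @cons u v w h p ih =>
      have h1 : u + 1 = v ∨ v + 1 = u := by
        simpa [SimpleGraph.hasse_adj, Order.covBy_iff_add_one_eq] using h
      rw [SimpleGraph.Walk.length_cons, abs_le] at *
      push_cast
      omega
  obtain ⟨p, hp⟩ := SimpleGraph.exists_walk_of_edist_ne_top
    (ne_top_of_le_ne_top (ENat.natCast_ne_top r) h)
  rw [← hp] at h
  have h2 : p.length ≤ r := by exact_mod_cast h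
  exact (key a b p).trans (by exact_mod_cast h2)

lemma edist_le_iff_dist_le (hT : T.IsTree) {x y : V} {r : ℕ} :
    T.edist x y ≤ r ↔ T.dist x y ≤ r := by
  rw [← (hT.connected x y).coe_dist_eq_edist, Nat.cast_le]

variable [T.LocallyFinite]

lemma card_ball_treeLine (hT : T.IsTree) {d : ℕ} (hd : 2 ≤ d) (hreg : T.IsRegularOfDegree d)
    (x : V × ℤ) (r : ℕ) :
    (d - 1) ^ r ≤ {y | (treeLine T).edist x y ≤ r}.ncard ∧
      {y | (treeLine T).edist x y ≤ r}.ncard ≤ ((r + 1) * (d * (d - 1) ^ r)) * (2 * r + 1) := by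
  obtain ⟨x, k⟩ := x
  have hsub : {y | (treeLine T).edist (x, k) y ≤ r} ⊆
      {v | T.dist x v ≤ r} ×ˢ (Set.Icc (k - r) (k + r)) := by
    rintro ⟨y, l⟩ hy
    have hy' : (treeLine T).edist (x, k) (y, l) ≤ r := hy
    rw [SimpleGraph.edist_boxProd] at hy'
    refine ⟨(edist_le_iff_dist_le hT).1 (le_self_add.trans hy'), ?_⟩
    have := abs_le.1 (abs_sub_le_of_edist_le (le_add_self.trans hy'))
    simp only [Set.mem_Icc]
    omega
  obtain ⟨h1, h2⟩ := card_ball_le hT hd hreg x r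
  have hfin := (h1.prod (Set.finite_Icc (k - r : ℤ) (k + r)))
  constructor
  · obtain ⟨u, hu⟩ : ∃ u, T.Adj x u := by
      rw [← SimpleGraph.degree_pos_iff_exists_adj, hreg x]
      omega
    rw [← card_level hT hreg hu.symm r, ← Set.ncard_coe_finset]
    refine Set.ncard_le_ncard_of_injOn (fun v => (v, k)) ?_ (fun v _ w _ h => congrArg Prod.fst h)
      (hfin.subset hsub)
    intro v hv
    have := ((mem_level hT hu.symm).1 hv).1
    simp only [Set.mem_ofPred_eq, SimpleGraph.edist_boxProd, SimpleGraph.edist_self, add_zero]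
    exact (edist_le_iff_dist_le hT).2 this.le
  · refine (Set.ncard_le_ncard hsub hfin).trans ?_
    rw [Set.ncard_prod]
    refine Nat.mul_le_mul h2 (le_of_eq ?_)
    rw [← Finset.coe_Icc, Set.ncard_coe_finset, Int.card_Icc]
    omega

lemma gr_treeLine (hT : T.IsTree) {d : ℕ} (hd : 2 ≤ d) (hreg : T.IsRegularOfDegree d)
    (x : V × ℤ) : gr (treeLine T) x = d - 1 := by
  have hb : ((d - 1 : ℕ) : ℝ) = d - 1 := by
    push_cast [Nat.one_le_of_lt hd]
    ring
  have hb1 : (1 : ℝ) ≤ (d : ℝ) - 1 := by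
    have : (2 : ℝ) ≤ d := by exact_mod_cast hd
    linarith
  have hd0 : (0 : ℝ) < 6 * d := by linarith
  have lim1 : Tendsto (fun r : ℕ => (1 : ℝ) / r) atTop (𝓝 0) := tendsto_one_div_atTop_nhds_zero_nat
  have lim2 : Tendsto (fun r : ℕ => (r : ℝ) ^ ((1 : ℝ) / r)) atTop (𝓝 1) :=
    tendsto_rpow_div.comp tendsto_natCast_atTop_atTop
  have lim3 : Tendsto (fun r : ℕ => (6 * d : ℝ) ^ ((1 : ℝ) / r)) atTop (𝓝 1) := by
    have := (Real.continuousAt_const_rpow (b := 0) hd0.ne').tendsto.comp lim1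
    rwa [Real.rpow_zero] at this
  have lim4 : Tendsto (fun r : ℕ => (6 * d : ℝ) ^ ((1 : ℝ) / r) *
      ((r : ℝ) ^ ((1 : ℝ) / r) * (r : ℝ) ^ ((1 : ℝ) / r)) * ((d : ℝ) - 1)) atTop
      (𝓝 ((d : ℝ) - 1)) := by
    simpa using (lim3.mul (lim2.mul lim2)).mul_const ((d : ℝ) - 1)
  refine (tendsto_of_tendsto_of_tendsto_of_le_of_le' tendsto_const_nhds lim4 ?_ ?_).liminf_eq
  · filter_upwards [eventually_ge_atTop 1] with r hr
    have h1 : ((d : ℝ) - 1) ^ r ≤ ({y | (treeLine T).edist x y ≤ r}.ncard : ℝ) := by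
      have := (card_ball_treeLine hT hd hreg x r).1
      rw [← hb]
      exact_mod_cast this
    calc (d : ℝ) - 1 = (((d : ℝ) - 1) ^ r) ^ ((1 : ℝ) / r) := by
          rw [one_div, Real.pow_rpow_inv_natCast (by linarith) (by omega)]
      _ ≤ _ := Real.rpow_le_rpow (by positivity) h1 (by positivity)
  · filter_upwards [eventually_ge_atTop 1] with r hr
    have hr' : (1 : ℝ) ≤ r := by exact_mod_cast hr
    have h1 : ({y | (treeLine T).edist x y ≤ r}.ncard : ℝ) ≤
        6 * d * (r * r) * ((d : ℝ) - 1) ^ r := by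
      have h2 : ({y | (treeLine T).edist x y ≤ r}.ncard : ℝ) ≤
          ((r + 1) * (d * ((d : ℝ) - 1) ^ r)) * (2 * r + 1) := by
        have := (card_ball_treeLine hT hd hreg x r).2
        rw [← hb]
        exact_mod_cast this
      have h3 : ((r : ℝ) + 1) * (2 * r + 1) ≤ 6 * (r * r) := by nlinarith
      calc _ ≤ _ := h2
        _ = (((r : ℝ) + 1) * (2 * r + 1)) * (d * ((d : ℝ) - 1) ^ r) := by ring
        _ ≤ 6 * (r * r) * (d * ((d : ℝ) - 1) ^ r) := by gcongr
        _ = _ := by ring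
    refine (Real.rpow_le_rpow (by positivity) h1 (by positivity)).trans (le_of_eq ?_)
    have hb0 : (0 : ℝ) ≤ (d : ℝ) - 1 := by linarith
    rw [Real.mul_rpow (by positivity) (by positivity), Real.mul_rpow hd0.le (by positivity),
      Real.mul_rpow (x := (r : ℝ)) (y := r) (by positivity) (by positivity), one_div,
      Real.pow_rpow_inv_natCast hb0 (by omega)]

end Growth

section Percolation

variable {W : Type*} {G : SimpleGraph W}

/-! ### Connections inside a set of edges -/

instance (p : I) : IsProbabilityMeasure (perc G p) := by
  unfold perc
  infer_instance

/-- The subgraph consisting of the open edges in `S`. -/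
def openIn (G : SimpleGraph W) (S : Set (Sym2 W)) (ω : Config G) : SimpleGraph W :=
  SimpleGraph.fromEdgeSet {e | e ∈ S ∧ ∃ h : e ∈ G.edgeSet, ω ⟨e, h⟩ = true}

/-- The event that `x` and `y` are joined by a path of open edges in `S`. -/
def conn (G : SimpleGraph W) (S : Set (Sym2 W)) (x y : W) : Set (Config G) :=
  {ω | (openIn G S ω).Reachable x y}

/-- The probability of `conn G S x y`. -/
noncomputable def connProb (G : SimpleGraph W) (p : I) (S : Set (Sym2 W)) (x y : W) : ℝ :=
  (perc G p).real (conn G S x y)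

lemma openIn_adj {S : Set (Sym2 W)} {ω : Config G} {x y : W} :
    (openIn G S ω).Adj x y ↔ s(x, y) ∈ S ∧ ∃ h : G.Adj x y, ω ⟨s(x, y), h⟩ = true := by
  simp only [openIn, SimpleGraph.fromEdgeSet_adj, Set.mem_ofPred_eq, SimpleGraph.mem_edgeSet]
  exact ⟨fun h => h.1, fun h => ⟨h, h.2.1.ne⟩⟩

lemma openIn_univ (ω : Config G) : openIn G Set.univ ω = openGraph G ω := by
  simp [openIn, openGraph]

lemma connProb_univ (p : I) (x y : W) : connProb G p Set.univ x y = tau G p x y := by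
  simp only [connProb, conn, openIn_univ, tau]

lemma openIn_mono {S S' : Set (Sym2 W)} (h : S ⊆ S') (ω : Config G) :
    openIn G S ω ≤ openIn G S' ω := fun _ _ hxy =>
  openIn_adj.2 ⟨h (openIn_adj.1 hxy).1, (openIn_adj.1 hxy).2⟩

lemma conn_mono {S S' : Set (Sym2 W)} (h : S ⊆ S') (x y : W) : conn G S x y ⊆ conn G S' x y :=
  fun ω hω => SimpleGraph.Reachable.mono (openIn_mono h ω) hω

lemma connProb_mono (p : I) {S S' : Set (Sym2 W)} (h : S ⊆ S') (x y : W) :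
    connProb G p S x y ≤ connProb G p S' x y :=
  measureReal_mono (conn_mono h x y)

lemma connProb_nonneg (p : I) (S : Set (Sym2 W)) (x y : W) : 0 ≤ connProb G p S x y :=
  measureReal_nonneg

lemma connProb_le_one (p : I) (S : Set (Sym2 W)) (x y : W) : connProb G p S x y ≤ 1 :=
  measureReal_le_one

lemma connProb_self (p : I) (S : Set (Sym2 W)) (x : W) : connProb G p S x x = 1 := by
  have : conn G S x x = Set.univ := Set.eq_univ_of_forall fun ω => SimpleGraph.Reachable.refl x
  rw [connProb, this, probReal_univ]

lemma real_open_edge (p : I) (e : G.edgeSet) : (perc G p).real {ω | ω e = true} = p := by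
  have h : (perc G p).map (fun ω => ω e) = bernoulliMeasure true false p :=
    Measure.infinitePi_map_eval (fun _ : G.edgeSet => bernoulliMeasure true false p) e
  have h2 := map_measureReal_apply (μ := perc G p) (measurable_pi_apply e)
    (MeasurableSet.singleton true)
  rw [h, bernoulliMeasure_real_apply_of_mem_of_notMem p (.singleton true) rfl (by simp)] at h2
  exact h2.symm

lemma le_connProb_of_adj (p : I) {S : Set (Sym2 W)} {x y : W} (h : G.Adj x y)
    (hS : s(x, y) ∈ S) : (p : ℝ) ≤ connProb G p S x y := by
  rw [← real_open_edge p ⟨s(x, y), h⟩]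
  exact measureReal_mono fun ω hω => (openIn_adj.2 ⟨hS, h, hω⟩).reachable

/-- A vertex that is connected to another one has an open edge, and at `p = 0` there is none. -/
lemma tau_zero [Countable W] {x y : W} (h : x ≠ y) : tau G 0 x y = 0 := by
  have hsub : {ω : Config G | (openGraph G ω).Reachable x y} ⊆
      ⋃ z : W, {ω | ∃ h : G.Adj x z, ω ⟨s(x, z), h⟩ = true} := by
    rintro ω ⟨p⟩
    cases p with
    | nil => exact absurd rfl h
    | @cons _ z _ hxz q =>
      rw [← openIn_univ] at hxz
      exact Set.mem_iUnion.2 ⟨z, (openIn_adj.1 hxz).2⟩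
  have h0 : (perc G 0) (⋃ z : W, {ω | ∃ h : G.Adj x z, ω ⟨s(x, z), h⟩ = true}) = 0 := by
    refine measure_iUnion_null fun z => ?_
    by_cases hz : G.Adj x z
    · have := real_open_edge 0 (⟨s(x, z), hz⟩ : G.edgeSet)
      rw [measureReal_def, Set.Icc.coe_zero, ENNReal.toReal_eq_zero_iff] at this
      simpa [hz] using this.resolve_right (measure_ne_top _ _)
    · simp [hz]
  rw [tau, measureReal_def, measure_mono_null hsub h0, ENNReal.toReal_zero]

/-! ### Independence -/

/-- The σ-algebra generated by the states of the edges in `S`. -/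
@[reducible]
def edgeSigma (G : SimpleGraph W) (S : Set (Sym2 W)) : MeasurableSpace (Config G) :=
  ⨆ e ∈ {e : G.edgeSet | (e : Sym2 W) ∈ S}, MeasurableSpace.comap (fun ω : Config G => ω e) ⊤

lemma edgeSigma_le (S : Set (Sym2 W)) : edgeSigma G S ≤ MeasurableSpace.pi :=
  iSup₂_le fun e _ => (measurable_pi_apply e).comap_le

lemma edgeSigma_mono {S S' : Set (Sym2 W)} (h : S ⊆ S') : edgeSigma G S ≤ edgeSigma G S' :=
  iSup₂_le fun e he =>
    le_iSup₂_of_le (f := fun (e : G.edgeSet) (_ : e ∈ {e : G.edgeSet | (e : Sym2 W) ∈ S'}) =>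
      MeasurableSpace.comap (fun ω : Config G => ω e) ⊤) e (h he) le_rfl

lemma real_inter_of_disjoint (p : I) {S S' : Set (Sym2 W)} (h : Disjoint S S')
    {A B : Set (Config G)} (hA : MeasurableSet[edgeSigma G S] A)
    (hB : MeasurableSet[edgeSigma G S'] B) :
    (perc G p).real (A ∩ B) = (perc G p).real A * (perc G p).real B := by
  have h1 : iIndep (fun e : G.edgeSet => MeasurableSpace.comap (fun ω : Config G => ω e) ⊤)
      (perc G p) :=
    iIndepFun_infinitePi (P := fun _ : G.edgeSet => bernoulliMeasure true false p)
      (X := fun _ => id) (fun _ => measurable_id)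
  have h2 : Indep (edgeSigma G S) (edgeSigma G S') (perc G p) :=
    indep_iSup_of_disjoint (fun e => (measurable_pi_apply e).comap_le) h1
      (Set.disjoint_left.2 fun e he he' => Set.disjoint_left.1 h he he')
  rw [measureReal_def, (Indep_iff _ _ _).1 h2 A B hA hB, ENNReal.toReal_mul]
  rfl

lemma measurableSet_adj (S : Set (Sym2 W)) (x y : W) :
    MeasurableSet[edgeSigma G S] {ω | (openIn G S ω).Adj x y} := by
  by_cases h : s(x, y) ∈ S ∧ G.Adj x y
  · have : {ω : Config G | (openIn G S ω).Adj x y} =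
        (fun ω : Config G => ω ⟨s(x, y), h.2⟩) ⁻¹' {true} := by
      ext ω
      simp [openIn_adj, h.1, h.2]
    rw [this]
    have hle := le_iSup₂_of_le
      (f := fun (e : G.edgeSet) (_ : e ∈ {e : G.edgeSet | (e : Sym2 W) ∈ S}) =>
        MeasurableSpace.comap (fun ω : Config G => ω e) ⊤) ⟨s(x, y), h.2⟩ h.1 le_rfl
    exact hle _ ⟨{true}, trivial, rfl⟩
  · have : {ω : Config G | (openIn G S ω).Adj x y} = ∅ := by
      ext ω
      simp only [openIn_adj, Set.mem_ofPred_eq, Set.mem_empty_iff_false, iff_false]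
      rintro ⟨h1, h2, -⟩
      exact h ⟨h1, h2⟩
    rw [this]
    exact @MeasurableSet.empty _ (edgeSigma G S)

/-- The event is a countable union over the lengths and the vertices of open walks. -/
lemma measurableSet_conn [Countable W] (S : Set (Sym2 W)) (x y : W) :
    MeasurableSet[edgeSigma G S] (conn G S x y) := by
  have step : ∀ (n : ℕ) (x : W), MeasurableSet[edgeSigma G S]
      {ω : Config G | ∃ w : (openIn G S ω).Walk x y, w.length = n} := by
    intro n
    induction n with
    | zero =>
      intro x
      by_cases h : x = y
      · subst h
        have : {ω : Config G | ∃ w : (openIn G S ω).Walk x x, w.length = 0} = Set.univ :=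
          Set.eq_univ_of_forall fun ω => ⟨SimpleGraph.Walk.nil, rfl⟩
        rw [this]
        exact @MeasurableSet.univ _ (edgeSigma G S)
      · have : {ω : Config G | ∃ w : (openIn G S ω).Walk x y, w.length = 0} = ∅ := by
          refine Set.eq_empty_of_forall_notMem fun ω hω => ?_
          obtain ⟨w, hw⟩ := hω
          exact h (SimpleGraph.Walk.eq_of_length_eq_zero hw)
        rw [this]
        exact @MeasurableSet.empty _ (edgeSigma G S)
    | succ n ih =>
      intro x
      have : {ω : Config G | ∃ w : (openIn G S ω).Walk x y, w.length = n + 1} =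
          ⋃ z : W, {ω | (openIn G S ω).Adj x z} ∩
            {ω | ∃ w : (openIn G S ω).Walk z y, w.length = n} := by
        ext ω
        simp only [Set.mem_iUnion]
        constructor
        · rintro ⟨w, hw⟩
          cases w with
          | nil => simp at hw
          | @cons _ z _ h q => exact ⟨z, h, q, by simpa using hw⟩
        · rintro ⟨z, h, q, hq⟩
          exact ⟨SimpleGraph.Walk.cons h q, by simpa using hq⟩
      rw [this]
      exact MeasurableSet.iUnion fun z => (measurableSet_adj S x z).inter (ih z)
  have : conn G S x y = ⋃ n : ℕ, {ω : Config G | ∃ w : (openIn G S ω).Walk x y, w.length = n} := by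
    ext ω
    simp only [Set.mem_iUnion]
    constructor
    · rintro ⟨w⟩
      exact ⟨_, w, rfl⟩
    · rintro ⟨_, w, _⟩
      exact ⟨w⟩
  rw [this]
  exact MeasurableSet.iUnion fun n => step n x

/-! ### Invariance under automorphisms -/

/-- The action of an automorphism of `G` on configurations. -/
noncomputable def relabel (φ : G ≃g G) : Config G ≃ᵐ Config G :=
  MeasurableEquiv.piCongrLeft (fun _ => Bool) φ.mapEdgeSet

lemma relabel_apply (φ : G ≃g G) (ω : Config G) (e : G.edgeSet) :
    relabel φ ω (φ.mapEdgeSet e) = ω e :=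
  Equiv.piCongrLeft_apply_apply (fun _ => Bool) φ.mapEdgeSet ω e

lemma real_relabel (p : I) (φ : G ≃g G) (A : Set (Config G)) :
    (perc G p).real (relabel φ ⁻¹' A) = (perc G p).real A := by
  have h : (perc G p).map (relabel φ) = perc G p :=
    Measure.infinitePi_map_piCongrLeft (μ := fun _ : G.edgeSet => bernoulliMeasure true false p)
      φ.mapEdgeSet
  rw [measureReal_def, measureReal_def, ← (relabel φ).map_apply, h]

lemma relabel_mem_conn (φ : G ≃g G) {S S' : Set (Sym2 W)}
    (hS : ∀ e, e.map φ ∈ S' ↔ e ∈ S) (x y : W) (ω : Config G) :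
    relabel φ ω ∈ conn G S' (φ x) (φ y) ↔ ω ∈ conn G S x y := by
  let ψ : openIn G S ω ≃g openIn G S' (relabel φ ω) :=
    ⟨φ.toEquiv, fun {a b} => by
      rw [openIn_adj, openIn_adj]
      refine and_congr (hS s(a, b)) ?_
      constructor
      · rintro ⟨h, h'⟩
        have hab : G.Adj a b := φ.map_adj_iff.1 h
        exact ⟨hab, (relabel_apply φ ω ⟨s(a, b), hab⟩).symm.trans h'⟩
      · rintro ⟨h, h'⟩
        exact ⟨φ.map_adj_iff.2 h, (relabel_apply φ ω ⟨s(a, b), h⟩).trans h'⟩⟩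
  exact SimpleGraph.Iso.reachable_iff (φ := ψ)

lemma connProb_iso (p : I) (φ : G ≃g G) {S S' : Set (Sym2 W)}
    (hS : ∀ e, e.map φ ∈ S' ↔ e ∈ S) (x y : W) :
    connProb G p S' (φ x) (φ y) = connProb G p S x y := by
  rw [connProb, ← real_relabel p φ]
  congr 1
  ext ω
  exact relabel_mem_conn φ hS x y ω

/-! ### Finitely many edges -/

/-- The pairs of vertices that are edges in the finite set `F`. -/
def finEdges (F : Finset G.edgeSet) : Set (Sym2 W) := {e | ∃ h : e ∈ G.edgeSet, ⟨e, h⟩ ∈ F}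

lemma finEdges_mono {F F' : Finset G.edgeSet} (h : F ⊆ F') : finEdges F ⊆ finEdges F' :=
  fun _ he => ⟨he.1, h he.2⟩

/-- The probability of a configuration on finitely many edges. -/
noncomputable def weight (p : I) {F : Finset G.edgeSet} (s : F → Bool) : ℝ :=
  ∏ e, if s e = true then (p : ℝ) else 1 - p

open Classical in
lemma real_preimage_restrict (p : I) (F : Finset G.edgeSet) (A : Set (F → Bool)) :
    (perc G p).real (F.restrict ⁻¹' A) = ∑ s, weight p s * A.indicator (fun _ => (1 : ℝ)) s := by
  classical
  have h1 : (perc G p).map F.restrict =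
      Measure.pi fun _ : F => bernoulliMeasure true false p :=
    Measure.infinitePi_map_restrict (fun _ : G.edgeSet => bernoulliMeasure true false p)
  have hA : MeasurableSet A := A.toFinite.measurableSet
  rw [← map_measureReal_apply (Finset.measurable_restrict F) hA, h1]
  have h2 : ∀ s : F → Bool, (Measure.pi fun _ : F => bernoulliMeasure true false p).real {s} =
      weight p s := by
    intro s
    rw [measureReal_def, Measure.pi_singleton, ENNReal.toReal_prod, weight]
    refine Finset.prod_congr rfl fun e _ => ?_
    change (bernoulliMeasure true false p).real {s e} = _
    rcases Bool.eq_false_or_eq_true (s e) with h | h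
    · rw [h, bernoulliMeasure_real_apply_of_mem_of_notMem p (.singleton true) rfl (by simp)]
      simp
    · rw [h, bernoulliMeasure_real_apply_of_notMem_of_mem p (.singleton false) (by simp) rfl]
      simp
  have h3 : (A.toFinset : Set (F → Bool)) = A := A.coe_toFinset
  rw [← h3, ← sum_measureReal_singleton, h3]
  simp only [h2, Set.indicator_apply, mul_ite, mul_one, mul_zero]
  rw [← Finset.sum_filter]
  congr 1
  ext s
  simp

open Classical in
/-- The configuration that agrees with `s` on `F` and is closed elsewhere. -/
noncomputable def extend {F : Finset G.edgeSet} (s : F → Bool) : Config G :=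
  fun e => if h : e ∈ F then s ⟨e, h⟩ else false

lemma extend_restrict_mem_conn {F : Finset G.edgeSet} {S : Set (Sym2 W)} (hS : S ⊆ finEdges F)
    (x y : W) (ω : Config G) : extend (F.restrict ω) ∈ conn G S x y ↔ ω ∈ conn G S x y := by
  have : openIn G S (extend (F.restrict ω)) = openIn G S ω := by
    ext a b
    rw [openIn_adj, openIn_adj]
    refine and_congr_right fun h => exists_congr fun h' => ?_
    obtain ⟨_, h2⟩ := hS h
    rw [extend, dif_pos h2]
    rfl
  simp only [conn, Set.mem_ofPred_eq, this]

lemma conn_eq_preimage {F : Finset G.edgeSet} {S : Set (Sym2 W)} (hS : S ⊆ finEdges F)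
    (x y : W) : conn G S x y = F.restrict ⁻¹' {s | extend s ∈ conn G S x y} := by
  ext ω
  exact (extend_restrict_mem_conn hS x y ω).symm

lemma extend_mem_conn_mono {F : Finset G.edgeSet} {S : Set (Sym2 W)} {x y : W} {s s' : F → Bool}
    (h : s ≤ s') (hs : extend s ∈ conn G S x y) : extend s' ∈ conn G S x y := by
  refine SimpleGraph.Reachable.mono ?_ hs
  intro a b hab
  rw [openIn_adj] at hab ⊢
  obtain ⟨h1, h2, h3⟩ := hab
  refine ⟨h1, h2, ?_⟩
  unfold extend at h3 ⊢
  split_ifs at h3 ⊢ with h4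
  have := h ⟨_, h4⟩
  rw [h3] at this
  exact top_le_iff.1 this

lemma weight_nonneg (p : I) {F : Finset G.edgeSet} (s : F → Bool) : 0 ≤ weight p s := by
  refine Finset.prod_nonneg fun e _ => ?_
  split_ifs
  · exact p.2.1
  · exact sub_nonneg.2 p.2.2

lemma weight_mul (p : I) {F : Finset G.edgeSet} (s t : F → Bool) :
    weight p s * weight p t = weight p (s ⊓ t) * weight p (s ⊔ t) := by
  simp only [weight, ← Finset.prod_mul_distrib]
  have key : ∀ x y : Bool, (if x = true then (p : ℝ) else 1 - p) *
      (if y = true then (p : ℝ) else 1 - p) = (if x ⊓ y = true then (p : ℝ) else 1 - p) *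
      (if x ⊔ y = true then (p : ℝ) else 1 - p) := by
    intro x y
    cases x <;> cases y <;> simp [mul_comm]
  exact Finset.prod_congr rfl fun e _ => key (s e) (t e)

/-- The Harris inequality for connection events on finitely many edges. -/
lemma harris_finite (p : I) {F : Finset G.edgeSet} {S S' : Set (Sym2 W)} (hS : S ⊆ finEdges F)
    (hS' : S' ⊆ finEdges F) (x y z w : W) : connProb G p S x y * connProb G p S' z w ≤
      (perc G p).real (conn G S x y ∩ conn G S' z w) := by
  classical
  have h1 : ∑ s : F → Bool, weight p s = 1 := by
    have := real_preimage_restrict p F Set.univ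
    simpa using this.symm
  have hmono : ∀ (S : Set (Sym2 W)) (x y : W), Monotone
      (({s | extend s ∈ conn G S x y} : Set (F → Bool)).indicator fun _ => (1 : ℝ)) := by
    intro S x y s s' h
    by_cases hs : extend s ∈ conn G S x y
    · rw [Set.indicator_of_mem (by exact hs),
        Set.indicator_of_mem (by exact extend_mem_conn_mono h hs)]
    · rw [Set.indicator_of_notMem (by exact hs)]
      exact Set.indicator_nonneg (fun _ _ => zero_le_one) _
  have h2 := fkg _ _ (fun s : F → Bool => weight p s) (weight_nonneg p)
    (fun s => Set.indicator_nonneg (fun _ _ => zero_le_one) s)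
    (fun s => Set.indicator_nonneg (fun _ _ => zero_le_one) s)
    (hmono S x y) (hmono S' z w) (fun s t => (weight_mul p s t).le)
  rw [h1, one_mul] at h2
  rw [connProb, connProb, conn_eq_preimage hS, conn_eq_preimage hS', ← Set.preimage_inter,
    real_preimage_restrict, real_preimage_restrict, real_preimage_restrict]
  refine h2.trans (le_of_eq (Finset.sum_congr rfl fun s _ => ?_))
  simp only [Set.indicator_apply, Set.mem_inter_iff]
  split_ifs <;> simp_all

lemma continuous_connProb_finite {F : Finset G.edgeSet} {S : Set (Sym2 W)}
    (hS : S ⊆ finEdges F) (x y : W) : Continuous fun p : I => connProb G p S x y := by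
  classical
  have : (fun p : I => connProb G p S x y) = fun p : I => ∑ s : F → Bool,
      weight p s *
        ({s | extend s ∈ conn G S x y} : Set (F → Bool)).indicator (fun _ => (1 : ℝ)) s := by
    funext p
    conv_lhs => rw [connProb, conn_eq_preimage hS]
    exact real_preimage_restrict p F _
  rw [this]
  refine continuous_finsetSum _ fun s _ => Continuous.mul ?_ continuous_const
  refine continuous_finsetProd _ fun e _ => ?_
  split_ifs <;> fun_prop

lemma exists_finEdges_of_mem_conn {S : Set (Sym2 W)} {x y : W} {ω : Config G}
    (h : ω ∈ conn G S x y) : ∃ F : Finset G.edgeSet, ω ∈ conn G (S ∩ finEdges F) x y := by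
  classical
  obtain ⟨w⟩ := h
  induction w with
  | nil => exact ⟨∅, SimpleGraph.Reachable.refl _⟩
  | @cons x z y hxz q ih =>
    obtain ⟨F, hF⟩ := ih
    obtain ⟨h1, h2, h3⟩ := openIn_adj.1 hxz
    let F' : Finset G.edgeSet := insert ⟨s(x, z), h2⟩ F
    have hF' : s(x, z) ∈ finEdges F' := ⟨h2, Finset.mem_insert_self _ _⟩
    have hadj : (openIn G (S ∩ finEdges F') ω).Adj x z := openIn_adj.2 ⟨⟨h1, hF'⟩, h2, h3⟩
    exact ⟨F', hadj.reachable.trans (conn_mono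
      (Set.inter_subset_inter_right _ (finEdges_mono (Finset.subset_insert _ _))) _ _ hF)⟩

lemma conn_eq_iUnion (S : Set (Sym2 W)) (x y : W) :
    conn G S x y = ⋃ F : Finset G.edgeSet, conn G (S ∩ finEdges F) x y := by
  refine Set.Subset.antisymm (fun ω hω => Set.mem_iUnion.2 (exists_finEdges_of_mem_conn hω)) ?_
  exact Set.iUnion_subset fun F => conn_mono Set.inter_subset_left _ _

lemma monotone_conn_finEdges (S : Set (Sym2 W)) (x y : W) :
    Monotone fun F : Finset G.edgeSet => conn G (S ∩ finEdges F) x y := fun _ _ h =>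
  conn_mono (Set.inter_subset_inter_right _ (finEdges_mono h)) x y

lemma tendsto_connProb [Countable W] (p : I) (S : Set (Sym2 W)) (x y : W) :
    Tendsto (fun F : Finset G.edgeSet => connProb G p (S ∩ finEdges F) x y) atTop
      (𝓝 (connProb G p S x y)) := by
  have : Countable G.edgeSet := Subtype.countable
  rw [connProb, conn_eq_iUnion]
  exact (ENNReal.tendsto_toReal (measure_ne_top _ _)).comp
    (tendsto_measure_iUnion_atTop (monotone_conn_finEdges S x y))

/-- The Harris inequality for connection events. -/
lemma harris [Countable W] (p : I) (S S' : Set (Sym2 W)) (x y z w : W) :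
    connProb G p S x y * connProb G p S' z w ≤
      (perc G p).real (conn G S x y ∩ conn G S' z w) := by
  refine le_of_tendsto' ((tendsto_connProb p S x y).mul (tendsto_connProb p S' z w)) fun F => ?_
  refine (harris_finite p (F := F) Set.inter_subset_right Set.inter_subset_right x y z w).trans ?_
  exact measureReal_mono (Set.inter_subset_inter (conn_mono Set.inter_subset_left _ _)
    (conn_mono Set.inter_subset_left _ _))

lemma connProb_mul_le [Countable W] (p : I) (S : Set (Sym2 W)) (x y z : W) :
    connProb G p S x y * connProb G p S y z ≤ connProb G p S x z :=
  (harris p S S x y y z).trans (measureReal_mono fun _ hω =>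
    SimpleGraph.Reachable.trans hω.1 hω.2)

end Percolation

section Branching

variable {V : Type*} {T : SimpleGraph V}

/-! ### Regions of the product of a tree with the line -/

/-- The edges of `T □ ℤ` within distance `R` of the line over `o`, in the tree coordinate. -/
def ballEdges (T : SimpleGraph V) (o : V) (R : ℕ) : Set (Sym2 (V × ℤ)) :=
  {e | ∀ x ∈ e, T.dist o x.1 ≤ R}

/-- The edges of `T □ ℤ` over the side of `u` of the edge from `a` to `u`. -/
def sideEdges (T : SimpleGraph V) (a u : V) : Set (Sym2 (V × ℤ)) :=
  {e | ∀ x ∈ e, x.1 ∈ side T a u}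

/-- The edges of `T □ ℤ` over the side of `u` of the edge from `a` to `u`, up to distance `N` from
`u` in the tree coordinate. The vertical edges at distance exactly `N` are left out, so that no edge
belongs to the sides of the vertices at distance `N`. -/
def slabEdges (T : SimpleGraph V) (a u : V) (N : ℕ) : Set (Sym2 (V × ℤ)) :=
  {e | (∀ x ∈ e, x.1 ∈ side T a u ∧ T.dist u x.1 ≤ N) ∧ ∃ x ∈ e, T.dist u x.1 < N}

lemma slabEdges_subset (a u : V) (N : ℕ) : slabEdges T a u N ⊆ sideEdges T a u :=
  fun _ he x hx => (he.1 x hx).1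

/-- The automorphism of `T □ ℤ` induced by an automorphism of `T`. -/
def liftIso (f : T ≃g T) : treeLine T ≃g treeLine T where
  toEquiv := f.toEquiv.prodCongr (Equiv.refl ℤ)
  map_rel_iff' := by
    intro x y
    have := f.map_adj_iff (v := x.1) (w := y.1)
    simp [SimpleGraph.boxProd_adj, this]

lemma liftIso_apply (f : T ≃g T) (x : V × ℤ) : liftIso f x = (f x.1, x.2) := rfl

lemma mem_ballEdges_iso (hT : T.IsTree) (f : T ≃g T) (o : V) (R : ℕ) (e : Sym2 (V × ℤ)) :
    e.map (liftIso f) ∈ ballEdges T (f o) R ↔ e ∈ ballEdges T o R := by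
  simp only [ballEdges, Set.mem_ofPred_eq, Sym2.mem_map, forall_exists_index, and_imp,
    forall_apply_eq_imp_iff₂, liftIso_apply, dist_iso hT]

lemma mem_side_iso (hT : T.IsTree) (f : T ≃g T) (a u x : V) :
    f x ∈ side T (f a) (f u) ↔ x ∈ side T a u := by
  simp only [side, Set.mem_ofPred_eq, dist_iso hT]

lemma mem_slabEdges_iso (hT : T.IsTree) (f : T ≃g T) (a u : V) (N : ℕ) (e : Sym2 (V × ℤ)) :
    e.map (liftIso f) ∈ slabEdges T (f a) (f u) N ↔ e ∈ slabEdges T a u N := by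
  simp only [slabEdges, Set.mem_ofPred_eq, Sym2.mem_map, forall_exists_index, and_imp,
    forall_apply_eq_imp_iff₂, liftIso_apply, dist_iso hT, mem_side_iso hT]
  refine and_congr_right fun _ => ?_
  constructor
  · rintro ⟨_, ⟨y, hy, rfl⟩, h⟩
    exact ⟨y, hy, by rwa [dist_iso hT] at h⟩
  · rintro ⟨y, hy, h⟩
    exact ⟨_, ⟨y, hy, rfl⟩, by rwa [dist_iso hT]⟩

lemma exists_geodesic (hT : T.IsTree) (a w : V) : ∃ y : ℕ → V, y 0 = a ∧ y (T.dist a w) = w ∧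
    ∀ i k, i + k ≤ T.dist a w → T.dist (y i) (y (i + k)) = k := by
  obtain ⟨p, hp⟩ := hT.connected.exists_walk_length_eq_dist a w
  have h0 : p.getVert 0 = a := p.getVert_zero
  have h1 : p.getVert (T.dist a w) = w := by rw [← hp, p.getVert_length]
  have key : ∀ i k, i + k ≤ T.dist a w → T.dist (p.getVert i) (p.getVert (i + k)) ≤ k := by
    intro i k
    induction k with
    | zero => simp
    | succ k ih =>
      intro h
      have e1 : T.dist (p.getVert (i + k)) (p.getVert (i + k + 1)) = 1 :=
        SimpleGraph.dist_eq_one_iff_adj.2 (p.adj_getVert_succ (by omega))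
      have e2 := hT.connected.dist_triangle (u := p.getVert i) (v := p.getVert (i + k))
        (w := p.getVert (i + k + 1))
      have e3 := ih (by omega)
      rw [← add_assoc]
      omega
  refine ⟨p.getVert, h0, h1, fun i k h => le_antisymm (key i k h) ?_⟩
  have e1 := key 0 i (by omega)
  have e2 := key (i + k) (T.dist a w - (i + k)) (by omega)
  rw [zero_add, h0] at e1
  rw [Nat.add_sub_cancel' h, h1] at e2
  have e3 := hT.connected.dist_triangle (u := a) (v := p.getVert i) (w := w)
  have e4 := hT.connected.dist_triangle (u := p.getVert i) (v := p.getVert (i + k)) (w := w)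
  omega

variable [T.LocallyFinite]

lemma slabEdges_disjoint (hT : T.IsTree) {a u v : V} (h : T.Adj a u) {N : ℕ}
    (hv : v ∈ level T a u N) : Disjoint (slabEdges T a u N) (sideEdges T (par T a v) v) := by
  rw [Set.disjoint_left]
  rintro e ⟨-, x, hx, hlt⟩ he
  have := (dist_of_mem_level hT h hv (he x hx)).1
  omega

lemma sideEdges_disjoint (hT : T.IsTree) {a u v w : V} (h : T.Adj a u) {N : ℕ}
    (hv : v ∈ level T a u N) (hw : w ∈ level T a u N) (hne : v ≠ w) :
    Disjoint (sideEdges T (par T a v) v) (sideEdges T (par T a w) w) := by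
  rw [Set.disjoint_left]
  intro e he he'
  exact hne (eq_of_mem_side_of_mem_level hT h hv hw (he _ (Sym2.out_fst_mem e))
    (he' _ (Sym2.out_fst_mem e)))

lemma sideEdges_subset (hT : T.IsTree) {a u v : V} (h : T.Adj a u) {N : ℕ}
    (hv : v ∈ level T a u N) : sideEdges T (par T a v) v ⊆ sideEdges T a u :=
  fun _ he x hx => side_subset_of_mem_level hT h hv (he x hx)

lemma connProb_ballEdges_eq (hT : T.IsTree) {d : ℕ} (hreg : T.IsRegularOfDegree d) (p : I) (R : ℕ)
    {o v o' v' : V} (h : T.dist o v = T.dist o' v') :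
    connProb (treeLine T) p (ballEdges T o R) (o, 0) (v, 0) =
      connProb (treeLine T) p (ballEdges T o' R) (o', 0) (v', 0) := by
  obtain ⟨f, rfl, rfl⟩ := exists_iso hT hreg h
  exact (connProb_iso p (liftIso f) (mem_ballEdges_iso hT f o R) (o, 0) (v, 0)).symm

lemma tau_eq (hT : T.IsTree) {d : ℕ} (hreg : T.IsRegularOfDegree d) (p : I)
    {o v o' v' : V} (h : T.dist o v = T.dist o' v') :
    tau (treeLine T) p (o, 0) (v, 0) = tau (treeLine T) p (o', 0) (v', 0) := by
  obtain ⟨f, rfl, rfl⟩ := exists_iso hT hreg h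
  rw [← connProb_univ, ← connProb_univ]
  exact (connProb_iso p (liftIso f) (fun _ => by simp) (o, 0) (v, 0)).symm

/-! ### Connections across a slab -/

lemma pow_le_connProb {W : Type*} [Countable W] {G : SimpleGraph W} (p : I) (S : Set (Sym2 W))
    (f : ℕ → W) {c : ℝ} (hc : 0 ≤ c) (m : ℕ)
    (h : ∀ i < m, c ≤ connProb G p S (f i) (f (i + 1))) : c ^ m ≤ connProb G p S (f 0) (f m) := by
  induction m with
  | zero => simp [connProb_self]
  | succ m ih =>
    rw [pow_succ]
    exact (mul_le_mul (ih fun i hi => h i (by omega)) (h m (by omega)) hc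
      (connProb_nonneg _ _ _ _)).trans (connProb_mul_le p S _ _ _)

/-- Connections over `n` steps that stay near their starting line can be chained, after a straight
piece that leads into the slab and before one that leads out of it. -/
lemma le_connProb_slabEdges (hT : T.IsTree) {d : ℕ} (hd : 2 ≤ d) (hreg : T.IsRegularOfDegree d)
    (p : I) {o w : V} (R m : ℕ) {a u v : V} (h : T.Adj a u)
    (hv : v ∈ level T a u (R + m * T.dist o w + (R + 1))) :
    (p : ℝ) ^ (2 * R + 1) * connProb (treeLine T) p (ballEdges T o R) (o, 0) (w, 0) ^ m ≤
      connProb (treeLine T) p (slabEdges T a u (R + m * T.dist o w + (R + 1))) (u, 0) (v, 0) := by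
  have : Countable V := countable_of_isTree hT hd hreg
  set n := T.dist o w with hn
  set N := R + m * n + (R + 1) with hN
  set t := connProb (treeLine T) p (ballEdges T o R) (o, 0) (w, 0) with ht
  obtain ⟨hv1, hv2⟩ := (mem_level hT h).1 hv
  obtain ⟨y, hy0, hyv, hy⟩ := exists_geodesic hT a v
  rw [hv2] at hyv hy
  have hyu : y 1 = u := by
    have h1 : T.Adj (y 1) a := by
      have := hy 0 1 (by omega)
      rw [zero_add, hy0] at this
      exact (SimpleGraph.dist_eq_one_iff_adj.1 this).symm
    refine adj_dist_unique hT (o := v) h1 h.symm ?_ ?_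
    · have := hy 1 N (by omega)
      rw [add_comm 1 N, hyv] at this
      rw [T.dist_comm, hv2, T.dist_comm, this]
    · rw [T.dist_comm, hv2, T.dist_comm, hv1]
  let x : ℕ → V := fun i => y (1 + i)
  have hx0 : x 0 = u := hyu
  have hxv : x N = v := by
    rw [← hyv, add_comm]
  have hxx : ∀ i k, i + k ≤ N → T.dist (x i) (x (i + k)) = k := by
    intro i k hik
    have := hy (1 + i) k (by omega)
    rwa [add_assoc] at this
  have hxu : ∀ i ≤ N, T.dist u (x i) = i := by
    intro i hi
    have := hxx 0 i (by omega)
    rwa [zero_add, hx0] at this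
  have hxa : ∀ i ≤ N, T.dist a (x i) = i + 1 := by
    intro i hi
    have := hy 0 (1 + i) (by omega)
    rw [zero_add, hy0] at this
    exact this.trans (add_comm 1 i)
  have hside : ∀ i ≤ N, x i ∈ side T a u := by
    intro i hi
    simp only [side, Set.mem_ofPred_eq, hxu i hi, hxa i hi]
  set S := slabEdges T a u N with hS
  -- Connections along the geodesic itself.
  have straight : ∀ i k, i + k ≤ N →
      (p : ℝ) ^ k ≤ connProb (treeLine T) p S (x i, 0) (x (i + k), 0) := by
    intro i k hik
    refine pow_le_connProb p S (fun j => (x (i + j), (0 : ℤ))) p.2.1 k fun j hj => ?_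
    refine le_connProb_of_adj p ?_ ?_
    · rw [SimpleGraph.boxProd_adj_left, ← SimpleGraph.dist_eq_one_iff_adj]
      exact hxx (i + j) 1 (by omega)
    · refine ⟨fun z hz => ?_, (x (i + j), 0), Sym2.mem_mk_left _ _, ?_⟩
      · rcases Sym2.mem_iff.1 hz with rfl | rfl
        · exact ⟨hside (i + j) (by omega), by rw [hxu (i + j) (by omega)]; omega⟩
        · exact ⟨hside (i + (j + 1)) (by omega), by rw [hxu (i + (j + 1)) (by omega)]; omega⟩
      · rw [hxu (i + j) (by omega)]
        omega
  -- A vertex at distance at most `R` from `x l` is still on the side of `u`, since leaving that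
  -- side costs `l + 1 > R` steps.
  have hball : ∀ l, R ≤ l → l ≤ R + m * n → ballEdges T (x l) R ⊆ S := by
    intro l hl hl' e he
    have hle : ∀ z ∈ e, T.dist u z.1 < N := by
      intro z hz
      have e1 := he z hz
      have e2 := hxu l (by omega)
      have e3 := hT.connected.dist_triangle (u := u) (v := x l) (w := z.1)
      omega
    refine ⟨fun z hz => ⟨?_, (hle z hz).le⟩, _, Sym2.out_fst_mem e, hle _ (Sym2.out_fst_mem e)⟩
    by_contra hz'
    have e1 := he z hz
    have e2 := dist_of_mem_side hT h (hside l (by omega)) hz'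
    rw [hxu l (by omega), T.dist_comm] at e2
    omega
  have middle : t ^ m ≤ connProb (treeLine T) p S (x R, 0) (x (R + m * n), 0) := by
    have := pow_le_connProb (G := treeLine T) p S (fun j => (x (R + j * n), (0 : ℤ)))
      (c := t) (connProb_nonneg _ _ _ _) m fun j hj => ?_
    · simpa using this
    · have hjm : (j + 1) * n ≤ m * n := Nat.mul_le_mul_right n hj
      have e1 : R + (j + 1) * n = R + j * n + n := by ring
      rw [ht, connProb_ballEdges_eq hT hreg p R (o := o) (v := w) (o' := x (R + j * n))
        (v' := x (R + (j + 1) * n)) (by rw [e1, hxx _ _ (by omega)])]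
      exact connProb_mono p (hball _ (by omega) (by omega)) _ _
  have first := straight 0 R (by omega)
  have last := straight (R + m * n) (R + 1) (by omega)
  rw [zero_add, hx0] at first
  rw [← hN, hxv] at last
  have hp := p.2.1
  have ht0 : 0 ≤ t := connProb_nonneg _ _ _ _
  calc (p : ℝ) ^ (2 * R + 1) * t ^ m = (p : ℝ) ^ R * t ^ m * (p : ℝ) ^ (R + 1) := by ring
    _ ≤ connProb (treeLine T) p S (u, 0) (x R, 0) *
        connProb (treeLine T) p S (x R, 0) (x (R + m * n), 0) *
        connProb (treeLine T) p S (x (R + m * n), 0) (v, 0) := by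
      have := connProb_nonneg (G := treeLine T) p S (u, 0) (x R, 0)
      have := connProb_nonneg (G := treeLine T) p S (x R, 0) (x (R + m * n), 0)
      gcongr
    _ ≤ connProb (treeLine T) p S (u, 0) (x (R + m * n), 0) *
        connProb (treeLine T) p S (x (R + m * n), 0) (v, 0) :=
      mul_le_mul_of_nonneg_right (connProb_mul_le p S _ _ _) (connProb_nonneg _ _ _ _)
    _ ≤ _ := connProb_mul_le p S _ _ _

end Branching

section Survival

/-! ### A lower bound for the probability of a union -/

/-- Bonferroni's inequality: a lower bound for the probability of a union from bounds for the
events and their pairwise intersections. -/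
lemma le_real_biUnion {Ω ι : Type*} [MeasurableSpace Ω] (μ : Measure Ω) [IsProbabilityMeasure μ]
    (s : Finset ι) (B : ι → Set Ω) (hB : ∀ i ∈ s, MeasurableSet (B i)) {x y : ℝ} (hy : 0 ≤ y)
    (hx : ∀ i ∈ s, x ≤ μ.real (B i)) (hxy : ∀ i ∈ s, ∀ j ∈ s, i ≠ j → μ.real (B i ∩ B j) ≤ y) :
    s.card * x - (s.card : ℝ) ^ 2 * y ≤ μ.real (⋃ i ∈ s, B i) := by
  classical
  induction s using Finset.induction_on with
  | empty => simp
  | insert i s hi ih =>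
    have h1 := ih (fun j hj => hB j (Finset.mem_insert_of_mem hj))
      (fun j hj => hx j (Finset.mem_insert_of_mem hj))
      (fun j hj k hk => hxy j (Finset.mem_insert_of_mem hj) k (Finset.mem_insert_of_mem hk))
    have hU : MeasurableSet (⋃ j ∈ s, B j) :=
      Finset.measurableSet_biUnion _ fun j hj => hB j (Finset.mem_insert_of_mem hj)
    have h2 : μ.real (B i ∩ ⋃ j ∈ s, B j) ≤ s.card * y := by
      rw [Set.inter_iUnion₂]
      refine (measureReal_biUnion_finset_le s _).trans ?_
      rw [← nsmul_eq_mul]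
      refine Finset.sum_le_card_nsmul _ _ _ fun j hj => ?_
      refine hxy i (Finset.mem_insert_self _ _) j (Finset.mem_insert_of_mem hj) ?_
      rintro rfl
      exact hi hj
    have h3 := measureReal_union_add_inter (μ := μ) (s := B i) hU
      (measure_ne_top _ _) (measure_ne_top _ _)
    have h4 := hx i (Finset.mem_insert_self _ _)
    rw [Finset.set_biUnion_insert, Finset.card_insert_of_notMem hi]
    push_cast
    nlinarith [Nat.cast_nonneg (α := ℝ) s.card]

variable {V : Type*} {T : SimpleGraph V}

lemma par_iso (hT : T.IsTree) (f : T ≃g T) {a v : V} (h : v ≠ a) :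
    par T (f a) (f v) = f (par T a v) := by
  symm
  refine eq_par hT (f.map_adj_iff.2 (par_adj hT h)) ?_
  rw [dist_iso hT, dist_iso hT]
  exact dist_par hT h

variable [T.LocallyFinite]

/-! ### A branching process inside the percolation cluster -/

/-- Survival up to generation `k` of the branching process started from the edge from `a` to `u`:
the children of this edge are the edges that lead to the vertices `v` at distance `N` from `u` on
the side of `u` for which `(u, 0)` and `(v, 0)` are connected inside the slab between them. -/
def surv (T : SimpleGraph V) [T.LocallyFinite] (N : ℕ) : ℕ → V → V → Set (Config (treeLine T))
  | 0, _, _ => Set.univ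
  | k + 1, a, u => ⋃ v ∈ level T a u N,
      conn (treeLine T) (slabEdges T a u N) (u, 0) (v, 0) ∩ surv T N k (par T a v) v

lemma mem_surv_succ {N k : ℕ} {a u : V} {ω : Config (treeLine T)} :
    ω ∈ surv T N (k + 1) a u ↔ ∃ v ∈ level T a u N,
      ω ∈ conn (treeLine T) (slabEdges T a u N) (u, 0) (v, 0) ∧ ω ∈ surv T N k (par T a v) v := by
  simp only [surv, Set.mem_iUnion, exists_prop, Set.mem_inter_iff]

lemma measurableSet_surv [Countable V] (hT : T.IsTree) (N k : ℕ) {a u : V} (h : T.Adj a u) :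
    MeasurableSet[edgeSigma (treeLine T) (sideEdges T a u)] (surv T N k a u) := by
  induction k generalizing a u with
  | zero => exact @MeasurableSet.univ _ (edgeSigma _ _)
  | succ k ih =>
    refine Finset.measurableSet_biUnion _ fun v hv => ?_
    refine @MeasurableSet.inter _ (edgeSigma _ _) _ _ ?_ ?_
    · exact edgeSigma_mono (slabEdges_subset a u N) _ (measurableSet_conn _ _ _)
    · exact edgeSigma_mono (sideEdges_subset hT h hv) _ (ih (par_adj_of_mem_level hT h hv))

lemma surv_succ_subset (N k : ℕ) (a u : V) : surv T N (k + 1) a u ⊆ surv T N k a u := by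
  induction k generalizing a u with
  | zero => exact Set.subset_univ _
  | succ k ih =>
    intro ω hω
    obtain ⟨v, hv, h1, h2⟩ := mem_surv_succ.1 hω
    exact mem_surv_succ.2 ⟨v, hv, h1, ih _ _ h2⟩

lemma exists_reachable_of_mem_surv (hT : T.IsTree) {N k : ℕ} {a u : V} (h : T.Adj a u)
    {ω : Config (treeLine T)} (hω : ω ∈ surv T N k a u) : ∃ x ∈ side T a u, T.dist u x = k * N ∧
      (openGraph (treeLine T) ω).Reachable (u, 0) (x, 0) := by
  induction k generalizing a u with
  | zero =>
    refine ⟨u, ?_, by simp, SimpleGraph.Reachable.refl _⟩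
    simp [side, SimpleGraph.dist_eq_one_iff_adj.2 h]
  | succ k ih =>
    obtain ⟨v, hv, h1, h2⟩ := mem_surv_succ.1 hω
    obtain ⟨x, hx, hd, hr⟩ := ih (par_adj_of_mem_level hT h hv) h2
    refine ⟨x, side_subset_of_mem_level hT h hv hx, ?_, SimpleGraph.Reachable.trans ?_ hr⟩
    · rw [(dist_of_mem_level hT h hv hx).1, hd]
      ring
    · rw [← openIn_univ]
      exact conn_mono (Set.subset_univ _) _ _ h1

lemma relabel_mem_surv (hT : T.IsTree) (f : T ≃g T) (N k : ℕ) {a u : V} (h : T.Adj a u)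
    (ω : Config (treeLine T)) :
    relabel (liftIso f) ω ∈ surv T N k (f a) (f u) ↔ ω ∈ surv T N k a u := by
  induction k generalizing a u with
  | zero => simp [surv]
  | succ k ih =>
    have h' : T.Adj (f a) (f u) := f.map_adj_iff.2 h
    have hl : ∀ v, f v ∈ level T (f a) (f u) N ↔ v ∈ level T a u N := by
      intro v
      rw [mem_level hT h, mem_level hT h', dist_iso hT, dist_iso hT]
    have hc : ∀ v ∈ level T a u N,
        (relabel (liftIso f) ω ∈ conn (treeLine T) (slabEdges T (f a) (f u) N) (f u, 0) (f v, 0) ∧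
          relabel (liftIso f) ω ∈ surv T N k (par T (f a) (f v)) (f v)) ↔
        (ω ∈ conn (treeLine T) (slabEdges T a u N) (u, 0) (v, 0) ∧
          ω ∈ surv T N k (par T a v) v) := by
      intro v hv
      rw [par_iso hT f (ne_of_mem_level hT h hv), ih (par_adj_of_mem_level hT h hv)]
      exact and_congr_left fun _ =>
        relabel_mem_conn (liftIso f) (mem_slabEdges_iso hT f a u N) (u, 0) (v, 0) ω
    rw [mem_surv_succ, mem_surv_succ]
    constructor
    · rintro ⟨w, hw, hw'⟩
      obtain ⟨v, rfl⟩ := f.surjective w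
      exact ⟨v, (hl v).1 hw, (hc v ((hl v).1 hw)).1 hw'⟩
    · rintro ⟨v, hv, hv'⟩
      exact ⟨f v, (hl v).2 hv, (hc v hv).2 hv'⟩

lemma real_surv_eq (hT : T.IsTree) {d : ℕ} (hreg : T.IsRegularOfDegree d) (p : I) (N k : ℕ)
    {a u a' u' : V} (h : T.Adj a u) (h' : T.Adj a' u') :
    (perc (treeLine T) p).real (surv T N k a u) =
      (perc (treeLine T) p).real (surv T N k a' u') := by
  obtain ⟨f, rfl, rfl⟩ := exists_iso hT hreg
    ((SimpleGraph.dist_eq_one_iff_adj.2 h).trans (SimpleGraph.dist_eq_one_iff_adj.2 h').symm)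
  rw [← real_relabel p (liftIso f) (surv T N k (f a) (f u))]
  congr 1
  ext ω
  exact (relabel_mem_surv hT f N k h ω).symm

/-- A supercritical branching process survives up to every generation with a probability that is
bounded below. If `s` is the survival probability up to one generation, then the survival
probability up to the next one is at least `M c s - M² s²` by inclusion-exclusion, which suffices
for small `s`, and at least `c s` since one child suffices, which settles the remaining case. -/
lemma le_real_surv (hT : T.IsTree) {d : ℕ} (hd : 2 ≤ d) (hreg : T.IsRegularOfDegree d) (p : I)
    (N : ℕ) {c : ℝ} (hc : 1 < ((d : ℝ) - 1) ^ N * c) (hc0 : 0 < c) (hc1 : c ≤ 1)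
    (hslab : ∀ a u v : V, T.Adj a u → v ∈ level T a u N →
      c ≤ connProb (treeLine T) p (slabEdges T a u N) (u, 0) (v, 0)) (k : ℕ) {a u : V}
    (h : T.Adj a u) : c * ((((d : ℝ) - 1) ^ N * c - 1) / (((d : ℝ) - 1) ^ N) ^ 2) ≤
      (perc (treeLine T) p).real (surv T N k a u) := by
  have : Countable V := countable_of_isTree hT hd hreg
  have hb : ((d - 1 : ℕ) : ℝ) = d - 1 := by
    push_cast [Nat.one_le_of_lt hd]
    ring
  have hM : ((level T a u N).card : ℝ) = ((d : ℝ) - 1) ^ N := by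
    rw [card_level hT hreg h]
    push_cast [hb]
    rfl
  set M := ((d : ℝ) - 1) ^ N with hMdef
  have hM1 : 1 ≤ M := by
    refine one_le_pow₀ ?_
    have : (2 : ℝ) ≤ d := by exact_mod_cast hd
    linarith
  set s₁ := (M * c - 1) / M ^ 2 with hs₁
  have hs₁0 : 0 < s₁ := div_pos (by linarith) (by positivity)
  have hs₁' : M ^ 2 * s₁ = M * c - 1 := by
    rw [hs₁]
    field_simp
  have hs₁1 : s₁ ≤ 1 := by
    rw [hs₁, div_le_one (by positivity)]
    nlinarith
  induction k with
  | zero =>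
    -- Here `s = 1`, while `c` and `s₁` are at most `1`.
    simp only [surv, probReal_univ]
    nlinarith
  | succ k ih =>
    set s := (perc (treeLine T) p).real (surv T N k a u) with hs
    have hs0 : 0 ≤ s := measureReal_nonneg
    have hchild : ∀ v ∈ level T a u N,
        (perc (treeLine T) p).real (surv T N k (par T a v) v) = s := fun v hv =>
      real_surv_eq hT hreg p N k (par_adj_of_mem_level hT h hv) h
    have hmeas : ∀ v ∈ level T a u N, MeasurableSet[edgeSigma (treeLine T)
        (sideEdges T (par T a v) v)] (surv T N k (par T a v) v) := fun v hv =>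
      measurableSet_surv hT N k (par_adj_of_mem_level hT h hv)
    have hB : ∀ v ∈ level T a u N, c * s ≤ (perc (treeLine T) p).real
        (conn (treeLine T) (slabEdges T a u N) (u, 0) (v, 0) ∩ surv T N k (par T a v) v) := by
      intro v hv
      rw [real_inter_of_disjoint p (slabEdges_disjoint hT h hv) (measurableSet_conn _ _ _)
        (hmeas v hv), hchild v hv]
      exact mul_le_mul_of_nonneg_right (hslab a u v h hv) hs0
    by_cases hle : s ≤ s₁
    · have h1 := le_real_biUnion (perc (treeLine T) p) (level T a u N)
        (fun v => conn (treeLine T) (slabEdges T a u N) (u, 0) (v, 0) ∩ surv T N k (par T a v) v)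
        (fun v hv => (edgeSigma_le _ _ (measurableSet_conn _ _ _)).inter
          (edgeSigma_le _ _ (hmeas v hv))) (y := s ^ 2) (by positivity) hB ?_
      · rw [hM] at h1
        refine le_trans ?_ h1
        nlinarith [mul_nonneg hs0 (sub_nonneg.2 hle), mul_pos hc0 hs₁0]
      · intro v hv w hw hvw
        refine (measureReal_mono
          (Set.inter_subset_inter Set.inter_subset_right Set.inter_subset_right)).trans ?_
        rw [real_inter_of_disjoint p (sideEdges_disjoint hT h hv hw hvw) (hmeas v hv) (hmeas w hw),
          hchild v hv, hchild w hw, sq]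
    · obtain ⟨v, hv⟩ : (level T a u N).Nonempty := by
        rw [← Finset.card_pos]
        have : (0 : ℝ) < ((level T a u N).card : ℝ) := by linarith
        exact_mod_cast this
      calc c * s₁ ≤ c * s := by nlinarith
        _ ≤ _ := hB v hv
        _ ≤ _ := measureReal_mono (Set.subset_biUnion_of_mem
          (u := fun v => conn (treeLine T) (slabEdges T a u N) (u, 0) (v, 0) ∩
            surv T N k (par T a v) v) hv) (measure_ne_top _ _)

lemma hasInfiniteCluster_of_mem_surv (hT : T.IsTree) {N : ℕ} (hN : 0 < N) {a u : V}
    (h : T.Adj a u) {ω : Config (treeLine T)} (hω : ω ∈ ⋂ k, surv T N k a u) :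
    HasInfiniteCluster (treeLine T) ω := by
  have : ∀ k, ∃ x, T.dist u x = k * N ∧
      (openGraph (treeLine T) ω).Reachable (u, 0) (x, 0) := fun k => by
    obtain ⟨x, -, hx⟩ := exists_reachable_of_mem_surv hT h (Set.mem_iInter.1 hω k)
    exact ⟨x, hx⟩
  choose x hx hr using this
  refine ⟨(openGraph (treeLine T) ω).connectedComponentMk (u, 0),
    Set.infinite_of_injective_forall_mem (f := fun k => (x k, (0 : ℤ))) ?_ ?_⟩
  · intro k l hkl
    have : x k = x l := congrArg Prod.fst hkl
    have h1 := hx k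
    rw [this, hx l] at h1
    exact (Nat.eq_of_mul_eq_mul_right hN h1).symm
  · intro k
    rw [SimpleGraph.ConnectedComponent.mem_supp_iff, SimpleGraph.ConnectedComponent.eq]
    exact (hr k).symm

/-- If the branching process has a positive survival probability, then there is an infinite cluster
almost surely, since it is started independently in arbitrarily many disjoint subtrees. -/
lemma ae_hasInfiniteCluster (hT : T.IsTree) {d : ℕ} (hd : 3 ≤ d) (hreg : T.IsRegularOfDegree d)
    (p : I) {N : ℕ} (hN : 0 < N) {s : ℝ} (hs : 0 < s)
    (hsurv : ∀ (k : ℕ) (a u : V), T.Adj a u → s ≤ (perc (treeLine T) p).real (surv T N k a u)) :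
    ∀ᵐ ω ∂(perc (treeLine T) p), HasInfiniteCluster (treeLine T) ω := by
  classical
  have : Countable V := countable_of_isTree hT (by omega) hreg
  set μ := perc (treeLine T) p with hμ
  obtain ⟨a⟩ := hT.connected.nonempty
  obtain ⟨u, h⟩ : ∃ u, T.Adj a u := by
    rw [← SimpleGraph.degree_pos_iff_exists_adj, hreg a]
    omega
  have hmeas : ∀ a u, T.Adj a u → MeasurableSet[edgeSigma (treeLine T) (sideEdges T a u)]
      (⋂ k, surv T N k a u)ᶜ := fun a u h =>
    @MeasurableSet.compl _ _ (edgeSigma _ _)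
      (@MeasurableSet.iInter _ _ (edgeSigma _ _) _ _ fun k => measurableSet_surv hT N k h)
  have hprob : ∀ a u, T.Adj a u → μ.real (⋂ k, surv T N k a u)ᶜ ≤ 1 - s := by
    intro a u h
    have h1 : s ≤ μ.real (⋂ k, surv T N k a u) := by
      have h2 : Tendsto (fun k => μ.real (surv T N k a u)) atTop
          (𝓝 (μ.real (⋂ k, surv T N k a u))) :=
        (ENNReal.tendsto_toReal (measure_ne_top _ _)).comp
          (tendsto_measure_iInter_atTop
            (fun k => (edgeSigma_le _ _ (measurableSet_surv hT N k h)).nullMeasurableSet)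
            (antitone_nat_of_succ_le fun k => surv_succ_subset N k a u)
            ⟨0, measure_ne_top _ _⟩)
      exact ge_of_tendsto' h2 fun k => hsurv k a u h
    have h3 := edgeSigma_le _ _ (hmeas a u h)
    rw [probReal_compl_eq_one_sub h3.of_compl]
    linarith
  have hs1 : 0 ≤ 1 - s := measureReal_nonneg.trans (hprob a u h)
  have key : ∀ (n : ℕ) (t : Finset V), t ⊆ level T a u n →
      μ.real (⋂ v ∈ t, (⋂ k, surv T N k (par T a v) v)ᶜ) ≤ (1 - s) ^ t.card := by
    intro n t
    induction t using Finset.induction_on with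
    | empty =>
      intro _
      simp
    | insert v t hv ih =>
      intro ht
      have hvl := ht (Finset.mem_insert_self _ _)
      have htl : ∀ w ∈ t, w ∈ level T a u n := fun w hw => ht (Finset.mem_insert_of_mem hw)
      have hdisj : Disjoint (sideEdges T (par T a v) v)
          (⋃ w ∈ t, sideEdges T (par T a w) w) := by
        rw [Set.disjoint_iUnion₂_right]
        intro w hw
        refine sideEdges_disjoint hT h hvl (htl w hw) ?_
        rintro rfl
        exact hv hw
      have hm : MeasurableSet[edgeSigma (treeLine T) (⋃ w ∈ t, sideEdges T (par T a w) w)]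
          (⋂ w ∈ t, (⋂ k, surv T N k (par T a w) w)ᶜ) :=
        Finset.measurableSet_biInter _ fun w hw =>
          edgeSigma_mono (Set.subset_biUnion_of_mem (u := fun w => sideEdges T (par T a w) w)
            (show w ∈ (t : Set V) from hw)) _ (hmeas _ _ (par_adj_of_mem_level hT h (htl w hw)))
      rw [Finset.set_biInter_insert, Finset.card_insert_of_notMem hv, pow_succ', hμ,
        real_inter_of_disjoint p hdisj (hmeas _ _ (par_adj_of_mem_level hT h hvl)) hm]
      exact mul_le_mul (hprob _ _ (par_adj_of_mem_level hT h hvl)) (ih htl) measureReal_nonneg hs1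
  -- The level of depth `n` has `(d - 1) ^ n ≥ n` vertices.
  have hbound : ∀ n : ℕ, μ.real {ω | ¬ HasInfiniteCluster (treeLine T) ω} ≤ (1 - s) ^ n := by
    intro n
    have hcard : n ≤ (level T a u n).card := by
      rw [card_level hT hreg h]
      exact (Nat.lt_pow_self (by omega)).le
    refine (measureReal_mono ?_).trans ((key n _ subset_rfl).trans
      (pow_le_pow_of_le_one hs1 (by linarith) hcard))
    intro ω hω
    refine Set.mem_iInter₂.2 fun v hv hω' => hω ?_
    exact hasInfiniteCluster_of_mem_surv hT hN (par_adj_of_mem_level hT h hv) hω'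
  have hzero : μ.real {ω | ¬ HasInfiniteCluster (treeLine T) ω} ≤ 0 :=
    ge_of_tendsto' (tendsto_pow_atTop_nhds_zero_of_lt_one hs1 (by linarith)) hbound
  rw [ae_iff]
  have := le_antisymm hzero measureReal_nonneg
  rwa [measureReal_def, ENNReal.toReal_eq_zero_iff, or_iff_left (measure_ne_top _ _)] at this

/-- If connections over distance `n` that stay near their starting line beat the growth of the tree,
then there is an infinite cluster almost surely. -/
lemma ae_hasInfiniteCluster_of_lt (hT : T.IsTree) {d : ℕ} (hd : 3 ≤ d)
    (hreg : T.IsRegularOfDegree d) (p : I) (hp : 0 < (p : ℝ)) {R : ℕ} {o w : V}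
    (hlt : 1 < ((d : ℝ) - 1) ^ T.dist o w *
      connProb (treeLine T) p (ballEdges T o R) (o, 0) (w, 0)) :
    ∀ᵐ ω ∂(perc (treeLine T) p), HasInfiniteCluster (treeLine T) ω := by
  set n := T.dist o w with hn
  set t := connProb (treeLine T) p (ballEdges T o R) (o, 0) (w, 0) with ht
  have hb : (0 : ℝ) < (d : ℝ) - 1 := by
    have : (3 : ℝ) ≤ d := by exact_mod_cast hd
    linarith
  have ht0 : 0 < t := by
    have : 0 ≤ t := connProb_nonneg _ _ _ _
    rcases this.eq_or_lt with h | h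
    · rw [← h, mul_zero] at hlt
      linarith
    · exact h
  obtain ⟨m, hm⟩ : ∃ m : ℕ, 1 < (((d : ℝ) - 1) * p) ^ (2 * R + 1) *
      (((d : ℝ) - 1) ^ n * t) ^ m := by
    have h0 : 0 < (((d : ℝ) - 1) * p) ^ (2 * R + 1) := by positivity
    obtain ⟨m, hm⟩ := ((tendsto_pow_atTop_atTop_of_one_lt hlt).eventually_gt_atTop
      (1 / (((d : ℝ) - 1) * p) ^ (2 * R + 1))).exists
    refine ⟨m, ?_⟩
    rwa [div_lt_iff₀' h0] at hm
  set N := R + m * n + (R + 1) with hN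
  have hslab : ∀ a u v : V, T.Adj a u → v ∈ level T a u N →
      (p : ℝ) ^ (2 * R + 1) * t ^ m ≤
        connProb (treeLine T) p (slabEdges T a u N) (u, 0) (v, 0) := fun a u v h hv =>
    le_connProb_slabEdges hT (by omega) hreg p R m h hv
  have hc : 1 < ((d : ℝ) - 1) ^ N * ((p : ℝ) ^ (2 * R + 1) * t ^ m) := by
    refine hm.trans_le (le_of_eq ?_)
    rw [mul_pow, mul_pow, hN]
    ring
  have hc0 : 0 < (p : ℝ) ^ (2 * R + 1) * t ^ m := by positivity
  have hc1 : (p : ℝ) ^ (2 * R + 1) * t ^ m ≤ 1 :=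
    mul_le_one₀ (pow_le_one₀ p.2.1 p.2.2) (by positivity)
      (pow_le_one₀ ht0.le (connProb_le_one _ _ _ _))
  exact ae_hasInfiniteCluster hT hd hreg p (by omega)
    (mul_pos hc0 (div_pos (by linarith) (by positivity)))
    fun k a u h => le_real_surv hT (by omega) hreg p N hc hc0 hc1 hslab k h

end Survival

section Decay

variable {V : Type*} {T : SimpleGraph V}

/-! ### The exponential decay rate of connection probabilities -/

/-- Fekete's lemma in multiplicative form. -/
lemma tendsto_rpow_of_supermultiplicative {f : ℕ → ℝ} (hpos : ∀ n, 0 < f n) (hle : ∀ n, f n ≤ 1)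
    (hmul : ∀ m n, f m * f n ≤ f (m + n)) :
    ∃ a, Tendsto (fun n : ℕ => f n ^ (1 / (n : ℝ))) atTop (𝓝 a) := by
  have hsub : Subadditive fun n => -Real.log (f n) := by
    intro m n
    have := Real.log_le_log (mul_pos (hpos m) (hpos n)) (hmul m n)
    rw [Real.log_mul (hpos m).ne' (hpos n).ne'] at this
    linarith
  have hbdd : BddBelow (Set.range fun n : ℕ => -Real.log (f n) / n) := by
    refine ⟨0, ?_⟩
    rintro _ ⟨n, rfl⟩
    exact div_nonneg (neg_nonneg.2 (Real.log_nonpos (hpos n).le (hle n))) (Nat.cast_nonneg n)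
  refine ⟨Real.exp (-hsub.lim), ?_⟩
  refine ((Real.continuous_exp.tendsto _).comp (hsub.tendsto_lim hbdd).neg).congr fun n => ?_
  rw [Function.comp_apply, Real.rpow_def_of_pos (hpos n)]
  congr 1
  ring

lemma exists_finEdges_subset_ballEdges (F : Finset (treeLine T).edgeSet) (o : V) :
    ∃ R, finEdges F ⊆ ballEdges T o R := by
  have h : ∀ e : Sym2 (V × ℤ), ∃ R, ∀ x ∈ e, T.dist o x.1 ≤ R := by
    intro e
    induction e with
    | _ x y =>
      refine ⟨max (T.dist o x.1) (T.dist o y.1), fun z hz => ?_⟩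
      rcases Sym2.mem_iff.1 hz with rfl | rfl
      · exact le_max_left _ _
      · exact le_max_right _ _
  choose r hr using h
  refine ⟨F.sup fun e => r e, ?_⟩
  rintro e ⟨he, heF⟩ x hx
  exact (hr e x hx).trans (Finset.le_sup (f := fun e : (treeLine T).edgeSet => r e) heF)

variable [T.LocallyFinite]

lemma pow_le_tau (hT : T.IsTree) {d : ℕ} (hd : 2 ≤ d) (hreg : T.IsRegularOfDegree d) (p : I)
    (o v : V) : (p : ℝ) ^ T.dist o v ≤ tau (treeLine T) p (o, 0) (v, 0) := by
  have : Countable V := countable_of_isTree hT hd hreg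
  obtain ⟨y, hy0, hyn, hy⟩ := exists_geodesic hT o v
  have := pow_le_connProb (G := treeLine T) p Set.univ (fun j => (y j, (0 : ℤ))) p.2.1
    (T.dist o v) fun j hj => le_connProb_of_adj p (by
      rw [SimpleGraph.boxProd_adj_left, ← SimpleGraph.dist_eq_one_iff_adj]
      exact hy j 1 (by omega)) (Set.mem_univ _)
  rwa [connProb_univ, hy0, hyn] at this

lemma tau_mul_le (hT : T.IsTree) {d : ℕ} (hd : 2 ≤ d) (hreg : T.IsRegularOfDegree d) (p : I)
    {o v : ℕ → V} (h : ∀ n, T.dist (o n) (v n) = n) (m n : ℕ) :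
    tau (treeLine T) p (o m, 0) (v m, 0) * tau (treeLine T) p (o n, 0) (v n, 0) ≤
      tau (treeLine T) p (o (m + n), 0) (v (m + n), 0) := by
  have : Countable V := countable_of_isTree hT hd hreg
  obtain ⟨y, hy0, hyn, hy⟩ := exists_geodesic hT (o (m + n)) (v (m + n))
  rw [h] at hyn hy
  have h1 := hy 0 m (by omega)
  have h2 := hy m n le_rfl
  rw [zero_add, hy0] at h1
  rw [hyn] at h2
  rw [tau_eq hT hreg p ((h m).trans h1.symm), tau_eq hT hreg p ((h n).trans h2.symm)]
  simp only [← connProb_univ]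
  exact connProb_mul_le p _ _ _ _

lemma exists_isAlpha (hT : T.IsTree) {d : ℕ} (hd : 2 ≤ d) (hreg : T.IsRegularOfDegree d) (p : I) :
    ∃ a, IsAlpha T p a := by
  have : Countable V := countable_of_isTree hT hd hreg
  obtain ⟨o⟩ := hT.connected.nonempty
  choose v hv using exists_dist_eq hT hd hreg o
  suffices h : ∃ a, Tendsto (fun n : ℕ => tau (treeLine T) p (o, 0) (v n, 0) ^ (1 / (n : ℝ)))
      atTop (𝓝 a) by
    obtain ⟨a, ha⟩ := h
    refine ⟨a, fun o' v' h' => ha.congr fun n => ?_⟩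
    have h1 : T.dist o' (v' n) = n := by rw [SimpleGraph.dist, h' n, ENat.toNat_natCast]
    rw [tau_eq hT hreg p ((hv n).trans h1.symm)]
  -- At `p = 0` the terms with `n ≥ 1` vanish and have no logarithm.
  rcases p.2.1.eq_or_lt with h0 | h0
  · obtain rfl : p = 0 := Subtype.ext h0.symm
    refine ⟨0, tendsto_const_nhds.congr' ?_⟩
    filter_upwards [eventually_ge_atTop 1] with n hn
    have hne : ((o, 0) : V × ℤ) ≠ (v n, 0) := by
      intro e
      have h1 := hv n
      rw [← show o = v n from congrArg Prod.fst e, SimpleGraph.dist_self] at h1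
      omega
    have hn' : (1 / (n : ℝ)) ≠ 0 := one_div_ne_zero (by exact_mod_cast (by omega : n ≠ 0))
    rw [tau_zero hne, Real.zero_rpow hn']
  · refine tendsto_rpow_of_supermultiplicative (fun n => ?_) (fun n => measureReal_le_one)
      (tau_mul_le hT hd hreg p (o := fun _ => o) hv)
    exact (pow_pos h0 _).trans_le (pow_le_tau hT hd hreg p o (v n))

/-- At the critical probability, connection probabilities do not beat the growth of the tree: by
continuity a finite set of edges would be responsible for it, and there would be an infinite
cluster already at some smaller parameter. -/
lemma tau_pc_le (hT : T.IsTree) {d : ℕ} (hd : 3 ≤ d) (hreg : T.IsRegularOfDegree d) {o w : V}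
    (hne : w ≠ o) :
    ((d : ℝ) - 1) ^ T.dist o w * tau (treeLine T) (pc (treeLine T)) (o, 0) (w, 0) ≤ 1 := by
  have : Countable V := countable_of_isTree hT (by omega) hreg
  by_contra! hlt
  have hpc : 0 < pc (treeLine T) := by
    rcases eq_or_lt_of_le (bot_le : ⊥ ≤ pc (treeLine T)) with h | h
    · have h' : pc (treeLine T) = 0 := h.symm
      rw [h', tau_zero (fun e => hne (congrArg Prod.fst e).symm), mul_zero] at hlt
      linarith
    · exact h
  rw [← connProb_univ] at hlt
  obtain ⟨F, hF⟩ := (((tendsto_connProb (pc (treeLine T)) Set.univ ((o, 0) : V × ℤ)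
    (w, 0)).const_mul (((d : ℝ) - 1) ^ T.dist o w)).eventually (lt_mem_nhds hlt)).exists
  have hcont : Continuous fun p : I => ((d : ℝ) - 1) ^ T.dist o w *
      connProb (treeLine T) p (Set.univ ∩ finEdges F) (o, 0) (w, 0) :=
    continuous_const.mul (continuous_connProb_finite Set.inter_subset_right _ _)
  have hev : ∀ᶠ p in 𝓝 (pc (treeLine T)), 0 < p ∧ 1 < ((d : ℝ) - 1) ^ T.dist o w *
      connProb (treeLine T) p (Set.univ ∩ finEdges F) (o, 0) (w, 0) :=
    (lt_mem_nhds hpc).and (hcont.continuousAt.eventually (lt_mem_nhds hF))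
  have : (𝓝[<] pc (treeLine T)).NeBot := nhdsLT_neBot_of_exists_lt ⟨0, hpc⟩
  obtain ⟨p, ⟨hp0, hp⟩, hplt⟩ := ((hev.filter_mono nhdsWithin_le_nhds).and
    (self_mem_nhdsWithin : ∀ᶠ p in 𝓝[<] pc (treeLine T), p < pc (treeLine T))).exists
  obtain ⟨R, hR⟩ := exists_finEdges_subset_ballEdges F o
  have hb : (0 : ℝ) < (d : ℝ) - 1 := by
    have : (3 : ℝ) ≤ d := by exact_mod_cast hd
    linarith
  have hinf := ae_hasInfiniteCluster_of_lt hT hd hreg p hp0 (R := R) (o := o) (w := w)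
    (hp.trans_le (mul_le_mul_of_nonneg_left
      (connProb_mono p (Set.inter_subset_right.trans hR) _ _) (by positivity)))
  have hle : pc (treeLine T) ≤ p := sInf_le hinf
  exact absurd hplt (not_lt.2 hle)

lemma le_of_isAlpha_pc (hT : T.IsTree) {d : ℕ} (hd : 2 ≤ d) (hreg : T.IsRegularOfDegree d) {a : ℝ}
    (ha : IsAlpha T (pc (treeLine T)) a) : a ≤ 1 / ((d : ℝ) - 1) := by
  obtain ⟨o⟩ := hT.connected.nonempty
  choose v hv using exists_dist_eq hT hd hreg o
  have hlim := ha o v fun n => by rw [← (hT.connected o (v n)).coe_dist_eq_edist, hv n]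
  refine le_of_tendsto hlim ?_
  filter_upwards [eventually_ge_atTop 1] with n hn
  set t := tau (treeLine T) (pc (treeLine T)) (o, 0) (v n, 0) with ht
  have ht0 : 0 ≤ t := measureReal_nonneg
  have hb : (0 : ℝ) < (d : ℝ) - 1 := by
    have : (2 : ℝ) ≤ d := by exact_mod_cast hd
    linarith
  have key : ((d : ℝ) - 1) ^ n * t ≤ 1 := by
    rcases hd.eq_or_lt with rfl | hd'
    · norm_num
      exact measureReal_le_one
    · have hne : v n ≠ o := by
        intro e
        have h1 := hv n
        rw [e, SimpleGraph.dist_self] at h1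
        omega
      have := tau_pc_le hT hd' hreg hne
      rwa [hv n] at this
  have h1 : t ≤ (1 / ((d : ℝ) - 1)) ^ n := by
    rw [one_div, inv_pow, ← one_div, le_div_iff₀' (by positivity)]
    exact key
  calc t ^ (1 / (n : ℝ)) ≤ ((1 / ((d : ℝ) - 1)) ^ n) ^ (1 / (n : ℝ)) :=
        Real.rpow_le_rpow ht0 h1 (by positivity)
    _ = _ := by rw [one_div (n : ℝ), Real.pow_rpow_inv_natCast (by positivity) (by omega)]

end Decay
end TreeLinePercolation

theorem mainTheorem4 {V : Type*} (T : SimpleGraph V) [T.LocallyFinite] (d : ℕ) (hd : 2 ≤ d)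
    (hT : T.IsTree) (hreg : T.IsRegularOfDegree d) :
    TreeLinePercolation.IsAlpha T (TreeLinePercolation.pc (TreeLinePercolation.treeLine T))
        (TreeLinePercolation.alpha T (TreeLinePercolation.pc (TreeLinePercolation.treeLine T))) ∧
      ∀ x : V × ℤ,
        TreeLinePercolation.alpha T (TreeLinePercolation.pc (TreeLinePercolation.treeLine T)) ≤
            (TreeLinePercolation.gr (TreeLinePercolation.treeLine T) x)⁻¹ ∧
          (TreeLinePercolation.gr (TreeLinePercolation.treeLine T) x)⁻¹ = 1 / ((d : ℝ) - 1) := by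
  have h := Classical.epsilon_spec (TreeLinePercolation.exists_isAlpha hT hd hreg
    (TreeLinePercolation.pc (TreeLinePercolation.treeLine T)))
  refine ⟨h, fun x => ?_⟩
  rw [TreeLinePercolation.gr_treeLine hT hd hreg x, ← one_div]
  exact ⟨TreeLinePercolation.le_of_isAlpha_pc hT hd hreg h, rfl⟩
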